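/- Let $(\Omega,\mathbb P)$ be a probability space and let $\{x_\alpha\}_{\alpha\in\mathbb Z}$ and $\{y_\alpha\}_{\alpha\in\mathbb Z}$ be two families of complex-valued (in particular, possibly real-valued) random variables on it. Suppose that the variables within each family are independent (they may, but need not, be identically distributed), that the two families are independent of each other, and that, for every $\alpha$ and every real $p\ge 1$, $$\mathbb E\,x_\alpha=\mathbb E\,y_\alpha=0,\qquad \mathbb E|x_\alpha|^2=\mathbb E|y_\alpha|^2=1,\qquad \sup_{\beta\in\mathbb Z}\mathbb E|x_\beta|^p<\infty,\qquad \sup_{\beta\in\mathbb Z}\mathbb E|y_\beta|^p<\infty .$$ A $*$-probability space $(\mathcal A,\varphi)$ is a unital complex $*$-algebra $\mathcal A$ with a linear functional $\varphi$ such that $\varphi(1)=1$ and $\varphi(a^*a)\ge 0$ for all $a\in\mathcal A$. A semi-circular variable is an element $s=s^*$ of $\mathcal A$ with $\varphi(s^{2k})=\frac1{k+1}\binom{2k}{k}$ and $\varphi(s^{2k+1})=0$ for all $k\ge 0$. A circular variable is an element $(s_1+i s_2)/\sqrt2$ with $s_1,s_2$ freely independent semi-circular variables. Elements $a_n\in(\mathcal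 A_n,\varphi_n)$ converge in $*$-distribution to $a\in(\mathcal A,\varphi)$ if $\varphi_n(Q(a_n,a_n^*))\to\varphi(Q(a,a^*))$ for every non-commutative polynomial $Q\in\mathbb C\langle X,X^*\rangle$. **Proposition (Linear link functions).** Let $L_X(i,j)=ai+bj+e$ and $L_Y(i,j)=ci+dj+f$, where $a,b,c,d,e,f$ are integers, $a,b,c,d$ are non-zero and $ad-bc\notin\{0,\pm bd,\pm ac\}$. Let $X_n=(x_{L_X(i,j)})_{1\le i,j\le n}$ and $Y_n=(y_{L_Y(i,j)})_{1\le i,j\le n}$, and let $X_n\odot Y_n$ be their entrywise product. Then $n^{-1/2}(X_n\odot Y_n)$, as an element of the $*$-probability space $\big(\mathcal M_n(L^{\infty,-}(\Omega,\mathbb P)),\tfrac1n\mathbb E\,\mathrm{tr}\big)$ with $L^{\infty,-}(\Omega,\mathbb P)=\bigcap_{1\le p<\infty}L^p(\Omega,\mathbb P)$, converges in $*$-distribution, as $n\to\infty$, to a circular variable; that is, there is a circular variable in some $*$-probability space to which it converges. -/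

import Mathlib

open MeasureTheory ProbabilityTheory Filter Topology
open scoped ENNReal NNReal ComplexOrder Matrix

noncomputable section

/-- A positive unital linear functional on a unital complex `*`-algebra `A`. A pair `(A, φ)` with
`φ : StarState A` is a `*`-probability space. -/
structure StarState (A : Type*) [Ring A] [StarRing A] [Algebra ℂ A] [StarModule ℂ A] where
  /-- the underlying linear functional -/
  toLin : A →ₗ[ℂ] ℂ
  map_one' : toLin 1 = 1
  nonneg' : ∀ a : A, 0 ≤ toLin (star a * a)

section FreeProbability

variable {A : Type*} [Ring A] [StarRing A] [Algebra ℂ A] [StarModule ℂ A]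

/-- Free independence of a family of unital subalgebras: `φ (a₁ ⋯ a_k) = 0` for every `k ≥ 1`
whenever the `a_j` are centred and neighbouring elements come from different subalgebras. The list
entry `(i, a)` records an element `a` together with the index `i` of its subalgebra. -/
def FreeSubalgebras (φ : StarState A) {ι : Type*} (S : ι → Subalgebra ℂ A) : Prop :=
  ∀ l : List (ι × A), l ≠ [] →
    (∀ p ∈ l, p.2 ∈ S p.1 ∧ φ.toLin p.2 = 0) →
    l.IsChain (fun p q => p.1 ≠ q.1) →
    φ.toLin (l.map Prod.snd).prod = 0

/-- Elements are freely independent if the unital subalgebras generated by each of them are. -/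
def FreeElements (φ : StarState A) {ι : Type*} (a : ι → A) : Prop :=
  FreeSubalgebras φ (fun i => Algebra.adjoin ℂ {a i})

/-- A (standard) semi-circular variable: self-adjoint, the even moments are the Catalan numbers and
the odd moments vanish. -/
def IsSemicircular (φ : StarState A) (s : A) : Prop :=
  IsSelfAdjoint s ∧
    (∀ k : ℕ, φ.toLin (s ^ (2 * k)) = (catalan k : ℂ)) ∧
    (∀ k : ℕ, φ.toLin (s ^ (2 * k + 1)) = 0)

/-- A circular variable: `c = (s₁ + i s₂) / √2` with `s₁, s₂` freely independent semi-circular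
variables. -/
def IsCircular (φ : StarState A) (c : A) : Prop :=
  ∃ s : Fin 2 → A, (∀ i, IsSemicircular φ (s i)) ∧ FreeElements φ s ∧
    c = ((Real.sqrt 2 : ℝ) : ℂ)⁻¹ • (s 0 + Complex.I • s 1)

/-- The `*`-distribution `Q ↦ φ (Q(a, a*))` of `a`, a functional on `ℂ⟨X, X*⟩`. Here `ℂ⟨X, X*⟩` is
the free algebra on two letters, `X` being the letter `false` and `X*` the letter `true`. -/
def starDistribution (φ : StarState A) (a : A) : FreeAlgebra ℂ Bool →ₗ[ℂ] ℂ :=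
  φ.toLin ∘ₗ (FreeAlgebra.lift ℂ (fun ε : Bool => if ε then star a else a)).toLinearMap

end FreeProbability

/-- Convergence in `*`-distribution of `a n ∈ (A n, φ n)` to `b ∈ (B, ψ)`. -/
def ConvergesInStarDistribution {A : ℕ → Type*} [∀ n, Ring (A n)] [∀ n, StarRing (A n)]
    [∀ n, Algebra ℂ (A n)] [∀ n, StarModule ℂ (A n)] (φ : ∀ n, StarState (A n)) (a : ∀ n, A n)
    {B : Type*} [Ring B] [StarRing B] [Algebra ℂ B] [StarModule ℂ B] (ψ : StarState B) (b : B) :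
    Prop :=
  ∀ Q : FreeAlgebra ℂ Bool,
    Tendsto (fun n => starDistribution (φ n) (a n) Q) atTop (𝓝 (starDistribution ψ b Q))

section RandomMatrices

variable {Ω : Type*} [MeasurableSpace Ω] (P : Measure Ω) [IsProbabilityMeasure P]

/-- `L^{∞,-}(Ω, P) = ⋂_{1 ≤ p < ∞} L^p(Ω, P)`, the unital `*`-algebra (under pointwise operations)
of complex random variables with all moments finite. -/
def LInftyMinus : StarSubalgebra ℂ (Ω → ℂ) where
  carrier := {f | Measurable f ∧ ∀ p : ℝ≥0, 1 ≤ p → MemLp f p P}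
  mul_mem' := by
    rintro f g ⟨hf, hf'⟩ ⟨hg, hg'⟩
    refine ⟨hf.mul hg, fun p hp => ?_⟩
    have h2 : (1 : ℝ≥0) ≤ 2 * p := hp.trans (le_mul_of_one_le_left' one_le_two)
    have : ENNReal.HolderTriple ((2 * p : ℝ≥0) : ℝ≥0∞) ((2 * p : ℝ≥0) : ℝ≥0∞) (p : ℝ≥0∞) := by
      constructor
      have hp0 : p ≠ 0 := (zero_lt_one.trans_le hp).ne'
      rw [← ENNReal.coe_inv (by positivity), ← ENNReal.coe_inv hp0, ← ENNReal.coe_add]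
      congr 1
      field_simp
      norm_num
    exact (hg' _ h2).mul (hf' _ h2)
  one_mem' := ⟨measurable_const, fun p _ => memLp_const 1⟩
  add_mem' := by
    rintro f g ⟨hf, hf'⟩ ⟨hg, hg'⟩
    exact ⟨hf.add hg, fun p hp => (hf' p hp).add (hg' p hp)⟩
  zero_mem' := ⟨measurable_const, fun p _ => MemLp.zero⟩
  algebraMap_mem' := fun r => ⟨measurable_const, fun p _ => memLp_const r⟩
  star_mem' := by
    rintro f ⟨hf, hf'⟩
    exact ⟨Complex.continuous_conj.measurable.comp hf, fun p hp => (hf' p hp).star⟩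

theorem LInftyMinus.integrable (f : LInftyMinus P) : Integrable (f : Ω → ℂ) P := by
  have h := f.2.2 1 le_rfl
  rwa [ENNReal.coe_one, memLp_one_iff_integrable] at h

/-- The expectation `E` on `L^{∞,-}(Ω, P)`. -/
def LInftyMinus.expectation : LInftyMinus P →ₗ[ℂ] ℂ where
  toFun f := ∫ ω, (f : Ω → ℂ) ω ∂P
  map_add' f g := integral_add (LInftyMinus.integrable P f) (LInftyMinus.integrable P g)
  map_smul' r f := integral_smul r (f : Ω → ℂ)

theorem LInftyMinus.expectation_star_mul_self_nonneg (f : LInftyMinus P) :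
    0 ≤ LInftyMinus.expectation P (star f * f) := by
  have h : LInftyMinus.expectation P (star f * f)
      = ((∫ ω, ‖(f : Ω → ℂ) ω‖ ^ 2 ∂P : ℝ) : ℂ) := by
    rw [← integral_complex_ofReal]
    refine integral_congr_ae (Eventually.of_forall fun ω => ?_)
    change (starRingEnd ℂ) ((f : Ω → ℂ) ω) * (f : Ω → ℂ) ω = _
    rw [Complex.conj_mul']
    push_cast
    rfl
  rw [h, Complex.zero_le_real]
  exact integral_nonneg fun ω => by positivity

/-- The state `(1/n) E tr` on `M_n(L^{∞,-}(Ω, P))`, for `n ≥ 1`. The `*`-operation of the matrix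
algebra is the conjugate transpose. -/
def matrixState (n : ℕ) [NeZero n] :
    StarState (Matrix (Fin n) (Fin n) (LInftyMinus P)) where
  toLin := (n : ℂ)⁻¹ • (LInftyMinus.expectation P ∘ₗ Matrix.traceLinearMap (Fin n) ℂ _)
  map_one' := by
    have h1 : ∀ m : ℕ, LInftyMinus.expectation P (m : LInftyMinus P) = m := fun m => by
      change ∫ _, (m : ℂ) ∂P = m
      simp
    have hn : (n : ℂ) ≠ 0 := Nat.cast_ne_zero.mpr (NeZero.ne n)
    simp [Matrix.trace_one, h1, hn]
  nonneg' := by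
    intro a
    have h : 0 ≤ LInftyMinus.expectation P (Matrix.trace (star a * a)) := by
      simp only [Matrix.trace, Matrix.diag_apply, Matrix.mul_apply, Matrix.star_apply, map_sum]
      exact Finset.sum_nonneg fun i _ => Finset.sum_nonneg fun j _ =>
        LInftyMinus.expectation_star_mul_self_nonneg P (a j i)
    have hn : (0 : ℂ) ≤ (n : ℂ)⁻¹ := by
      rw [← Complex.ofReal_natCast, ← Complex.ofReal_inv, Complex.zero_le_real]
      positivity
    exact mul_nonneg hn h

variable {P}

/-- Input random variables: independent, centred, of unit variance, and for each order `p` the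
`p`-th absolute moments are uniformly bounded. -/
structure IsInputEnsemble (x : ℤ → LInftyMinus P) : Prop where
  indep : iIndepFun (fun α => (x α : Ω → ℂ)) P
  mean_zero : ∀ α, ∫ ω, (x α : Ω → ℂ) ω ∂P = 0
  unit_variance : ∀ α, ∫ ω, ‖(x α : Ω → ℂ) ω‖ ^ 2 ∂P = 1
  bounded_moments : ∀ p : ℝ, 1 ≤ p → ⨆ α, ∫⁻ ω, ‖(x α : Ω → ℂ) ω‖ₑ ^ p ∂P < ∞

/-- The patterned random matrix `((x_{L(i, j)}))_{1 ≤ i, j ≤ n}` with link function `L`. -/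
def patternedMatrix (n : ℕ) (L : ℕ → ℕ → ℤ) (x : ℤ → LInftyMinus P) :
    Matrix (Fin n) (Fin n) (LInftyMinus P) :=
  Matrix.of fun i j => x (L (i + 1) (j + 1))

end RandomMatrices

/-- The linear link function `(i, j) ↦ a i + b j + e`. -/
def linearLink (a b e : ℤ) (i j : ℕ) : ℤ := a * i + b * j + e

end

/-! The proof is the moment method. By linearity it suffices to treat words in the matrix and its
adjoint, and the trace of such a word is a sum over closed vertex paths. Independence of the two
families splits the weight of a path into an `x`-moment and a `y`-moment. By centring and
independence, each vanishes unless every label of its link function occurs at least twice along the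
path.

Call an edge an opener if both of its labels are new. Any other edge repeats an earlier label of one
of the two kinds, and since `a`, `b`, `c`, `d` are non-zero this fixes its end point. For a fixed
pattern of label coincidences, a path is therefore determined by its initial vertex and the end
points of its openers. Repetition allows at most `m / 2` openers, so at most `m / 2 + 1` vertices
are free, matching the normalization `n ^ (1 + m / 2)`. A pattern with fewer free parameters is
negligible. If none is lost, every free vertex can be varied with the others fixed, and the
differences of such paths are test vectors for the linear label equations. Because `a * d - b * c ≠
0`, they force both kinds of label to pair the edges in the same way, each closing edge to be the
reverse of the last unclosed opener, and the pairing to be non-crossing (`isReversalAt_of_tests`,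
`card_exceptional_of_labelKernel_eq`).

The surviving paths are those that cancel to nothing on a stack of edges. If their labels are
exactly paired, each pair contributes `E |x|² = E |y|² = 1`, so these paths only have to be counted:
up to normalization there are `stackCount` many (`tendsto_clearingCount`). The circular element is
realized on the full Fock space, where each letter pushes a symbol or pops the opposite one, so its
`*`-moments are the same numbers (`vacuumState_prod_circularLetter`). -/

/-! ### Ballot numbers and Catalan numbers. -/

/-- The number of paths with `n` steps `±1` from height `k` to height `0` that stay nonnegative. -/
def ballotCount : ℕ → ℕ → ℕ
  | k, 0 => if k = 0 then 1 else 0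
  | 0, n + 1 => ballotCount 1 n
  | k + 1, n + 1 => ballotCount (k + 2) n + ballotCount k n

theorem ballotCount_of_lt : ∀ {n k : ℕ}, n < k → ballotCount k n = 0
  | 0, k, h => by simp [ballotCount]; omega
  | n + 1, 0, h => by omega
  | n + 1, k + 1, h => by
    rw [ballotCount, ballotCount_of_lt (by omega), ballotCount_of_lt (by omega)]

theorem ballotCount_of_odd : ∀ {n k : ℕ}, Odd (n + k) → ballotCount k n = 0
  | 0, k, h => by
    rcases k with - | k
    · simp at h
    · simp [ballotCount]
  | n + 1, 0, h => by
    rw [ballotCount, ballotCount_of_odd (by grind)]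
  | n + 1, k + 1, h => by
    rw [ballotCount, ballotCount_of_odd (by grind), ballotCount_of_odd (by grind)]

theorem ballotCount_self : ∀ k : ℕ, ballotCount k k = 1
  | 0 => rfl
  | k + 1 => by rw [ballotCount, ballotCount_of_lt (by omega), ballotCount_self k]

/-- The reflection principle: among the paths with `p + 1` steps of the rarer sign, the bad ones
correspond to a choice of `p` steps. It is proved here through the Pascal recursion. -/
theorem ballotCount_add_choose : ∀ n k p : ℕ, n = 2 * p + 2 + k →
    ballotCount k n + n.choose p = n.choose (p + 1)
  | 0, k, p, h => by omega
  | n + 1, 0, 0, h => by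
    obtain rfl : n = 1 := by omega
    rfl
  | n + 1, 0, p + 1, h => by
    have h1 := ballotCount_add_choose n 1 p (by omega)
    -- At height `0` only the upward step is possible; the symmetry of the middle binomials replaces
    -- the missing downward term.
    have h2 : n.choose (p + 1 + 1) = n.choose (p + 1) :=
      Nat.choose_symm_of_eq_add (by omega)
    rw [ballotCount, Nat.choose_succ_succ', Nat.choose_succ_succ']
    omega
  | n + 1, k + 1, 0, h => by
    have h1 := ballotCount_add_choose n k 0 (by omega)
    have h2 := ballotCount_self n
    obtain rfl : n = k + 2 := by omega
    rw [ballotCount, h2]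
    simp at h1 ⊢
    omega
  | n + 1, k + 1, p + 1, h => by
    have h1 := ballotCount_add_choose n k (p + 1) (by omega)
    have h2 := ballotCount_add_choose n (k + 2) p (by omega)
    rw [ballotCount, Nat.choose_succ_succ', Nat.choose_succ_succ']
    omega

theorem ballotCount_zero_two_mul (k : ℕ) : ballotCount 0 (2 * k) = catalan k := by
  rcases k with - | k
  · simp [ballotCount]
  have h1 := ballotCount_add_choose (2 * (k + 1)) 0 k (by ring)
  have h2 := Nat.choose_succ_right_eq (2 * (k + 1)) k
  have h3 := succ_mul_catalan_eq_centralBinom (k + 1)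
  rw [Nat.centralBinom_eq_two_mul_choose] at h3
  have h4 : 2 * (k + 1) - k = k + 2 := by omega
  rw [h4] at h2
  have : (k + 2) * ballotCount 0 (2 * (k + 1)) = (k + 2) * catalan (k + 1) := by
    rw [h3]
    linarith [congrArg ((k + 2) * ·) h1]
  exact Nat.eq_of_mul_eq_mul_left (by omega) this

/-! ### Free semicircular elements on the full Fock space. -/

noncomputable section

/-- The full Fock space over `ℂ²`, with the words in two letters as an orthonormal basis. -/
abbrev FockSpace : Type := lp (fun _ : List (Fin 2) => ℂ) 2

namespace FockSpace

/-- The basis vector of a word. -/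
def basisVec (w : List (Fin 2)) : FockSpace := lp.single 2 w 1

theorem inner_basisVec_left (w : List (Fin 2)) (f : FockSpace) : inner ℂ (basisVec w) f = f w := by
  rw [basisVec, lp.inner_single_left]
  simp

theorem basisVec_apply (w v : List (Fin 2)) : basisVec w v = if v = w then 1 else 0 := by
  rw [basisVec, lp.single_apply, Pi.single_apply]

theorem inner_basisVec (v w : List (Fin 2)) :
    inner ℂ (basisVec v) (basisVec w) = if v = w then (1 : ℂ) else 0 := by
  rw [inner_basisVec_left, basisVec_apply]

theorem orthonormal_cons (i : Fin 2) : Orthonormal ℂ (fun w => basisVec (i :: w)) := by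
  classical
  rw [orthonormal_iff_ite]
  intro v w
  rw [inner_basisVec]
  simp

/-- The left creation operator of a letter. -/
def creation (i : Fin 2) : FockSpace →L[ℂ] FockSpace :=
  (orthonormal_cons i).orthogonalFamily.linearIsometry.toContinuousLinearMap

theorem creation_basisVec (i : Fin 2) (w : List (Fin 2)) :
    creation i (basisVec w) = basisVec (i :: w) := by
  change (orthonormal_cons i).orthogonalFamily.linearIsometry (lp.single 2 w 1) = _
  rw [OrthogonalFamily.linearIsometry_apply_single]
  simp

theorem star_creation_basisVec (i : Fin 2) (w : List (Fin 2)) :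
    star (creation i) (basisVec w) = if w.head? = some i then basisVec w.tail else 0 := by
  ext v
  rw [← inner_basisVec_left, ContinuousLinearMap.star_eq_adjoint,
    ContinuousLinearMap.adjoint_inner_right, creation_basisVec, inner_basisVec]
  rcases w with - | ⟨j, w⟩
  · simp
  · by_cases h : j = i
    · subst h
      simp [basisVec_apply]
    · simp [h, Ne.symm h]

/-- The vacuum state. -/
def vacuumState : StarState (FockSpace →L[ℂ] FockSpace) where
  toLin :=
    { toFun := fun T => inner ℂ (basisVec []) (T (basisVec []))
      map_add' := fun S T => by simp
      map_smul' := fun r T => by simp }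
  map_one' := (inner_basisVec [] []).trans (if_pos rfl)
  nonneg' T := by
    change 0 ≤ inner ℂ (basisVec []) ((star T) (T (basisVec [])))
    rw [ContinuousLinearMap.star_eq_adjoint, ContinuousLinearMap.adjoint_inner_right,
      inner_self_eq_norm_sq_to_K]
    have : (0 : ℂ) ≤ ((‖T (basisVec [])‖ ^ 2 : ℝ) : ℂ) := by
      rw [Complex.zero_le_real]
      positivity
    exact this.trans_eq (Complex.ofReal_pow _ _)

theorem vacuumState_apply (T : FockSpace →L[ℂ] FockSpace) :
    vacuumState.toLin T = inner ℂ (basisVec []) (T (basisVec [])) := rfl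

/-- The sum of the creation operator of a letter and its adjoint. -/
def fieldOp (i : Fin 2) : FockSpace →L[ℂ] FockSpace := creation i + star (creation i)

theorem isSelfAdjoint_fieldOp (i : Fin 2) : IsSelfAdjoint (fieldOp i) :=
  IsSelfAdjoint.add_star_self _

theorem fieldOp_basisVec (i : Fin 2) (w : List (Fin 2)) :
    fieldOp i (basisVec w) =
      basisVec (i :: w) + if w.head? = some i then basisVec w.tail else 0 := by
  rw [fieldOp, add_apply, creation_basisVec, star_creation_basisVec]

/-- Moving one self-adjoint factor to the left vector lengthens or shortens the word by one letter,
which is the ballot recursion. -/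
theorem inner_fieldOp_pow (i : Fin 2) (n k : ℕ) :
    inner ℂ (basisVec (List.replicate k i)) ((fieldOp i ^ n) (basisVec [])) =
      (ballotCount k n : ℂ) := by
  induction n generalizing k with
  | zero =>
    rw [pow_zero, one_apply_eq_self, inner_basisVec]
    rcases k with - | k <;> simp [ballotCount, List.replicate_succ]
  | succ n ih =>
    have h : inner ℂ (basisVec (List.replicate k i)) ((fieldOp i ^ (n + 1)) (basisVec [])) =
        inner ℂ (fieldOp i (basisVec (List.replicate k i))) ((fieldOp i ^ n) (basisVec [])) := by
      rw [pow_succ', mul_apply_eq_comp, ← ContinuousLinearMap.adjoint_inner_left,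
        ← ContinuousLinearMap.star_eq_adjoint, isSelfAdjoint_fieldOp]
    rw [h, fieldOp_basisVec, ← List.replicate_succ, inner_add_left, ih]
    rcases k with - | k
    · simp [ballotCount]
    · simp only [List.replicate_succ, List.head?_cons, List.tail_cons, if_true, ballotCount, ih,
        Nat.cast_add]

theorem isSemicircular_fieldOp (i : Fin 2) : IsSemicircular vacuumState (fieldOp i) := by
  have h (n : ℕ) : vacuumState.toLin (fieldOp i ^ n) = (ballotCount 0 n : ℂ) :=
    inner_fieldOp_pow i n 0
  refine ⟨isSelfAdjoint_fieldOp i, fun k => ?_, fun k => ?_⟩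
  · rw [h, ballotCount_zero_two_mul]
  · rw [h, ballotCount_of_odd (by simp), Nat.cast_zero]

/-- The vector `ξ ⊗ w` with `ξ` in the Fock space over the line of the letter `i`. -/
def prependPowers (i : Fin 2) (w : List (Fin 2)) : (ℕ →₀ ℂ) →ₗ[ℂ] FockSpace :=
  Finsupp.linearCombination ℂ fun n => basisVec (List.replicate n i ++ w)

/-- A word `w` not starting with `i` is an inert tensor factor: polynomials in `fieldOp i` act only
on the powers of `i` in front of it. The point is that `S` does not depend on `w`. -/
theorem exists_adjoin_fieldOp_intertwine (i : Fin 2) {T : FockSpace →L[ℂ] FockSpace}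
    (hT : T ∈ Algebra.adjoin ℂ {fieldOp i}) :
    ∃ S : (ℕ →₀ ℂ) →ₗ[ℂ] (ℕ →₀ ℂ), ∀ w : List (Fin 2), w.head? ≠ some i →
      ∀ ξ, T (prependPowers i w ξ) = prependPowers i w (S ξ) := by
  induction hT using Algebra.adjoin_induction with
  | mem T hT =>
    obtain rfl : T = fieldOp i := by simpa using hT
    refine ⟨Finsupp.linearCombination ℂ fun n => Finsupp.single (n + 1) 1 +
      if n = 0 then 0 else Finsupp.single (n - 1) 1, fun w hw ξ => ?_⟩
    induction ξ using Finsupp.induction_linear with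
    | zero => simp
    | add f g hf hg => simp only [map_add, hf, hg]
    | single n r =>
      rcases n with - | n
      · simp [prependPowers, fieldOp_basisVec, hw]
      · simp [prependPowers, fieldOp_basisVec, List.replicate_succ]
  | algebraMap r =>
    refine ⟨r • LinearMap.id, fun w _ ξ => ?_⟩
    simp [Algebra.algebraMap_eq_smul_one]
  | add T T' _ _ h h' =>
    obtain ⟨S, hS⟩ := h
    obtain ⟨S', hS'⟩ := h'
    exact ⟨S + S', fun w hw ξ => by simp [hS w hw, hS' w hw]⟩
  | mul T T' _ _ h h' =>
    obtain ⟨S, hS⟩ := h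
    obtain ⟨S', hS'⟩ := h'
    exact ⟨S ∘ₗ S', fun w hw ξ => by simp [hS w hw, hS' w hw]⟩

/-- The span of the words that start with the letter `i`. -/
def wordsFrom (i : Fin 2) : Submodule ℂ FockSpace :=
  Submodule.span ℂ (Set.range fun w => basisVec (i :: w))

/-- The coefficient of `w` in `T w` is the same as that of the vacuum in `T` applied to the vacuum,
namely the state of `T`. For centred `T` only words with an additional `i` in front remain. -/
theorem adjoin_fieldOp_basisVec_mem (i : Fin 2) {T : FockSpace →L[ℂ] FockSpace}
    (hT : T ∈ Algebra.adjoin ℂ {fieldOp i}) (h0 : vacuumState.toLin T = 0)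
    {w : List (Fin 2)} (hw : w.head? ≠ some i) : T (basisVec w) ∈ wordsFrom i := by
  obtain ⟨S, hS⟩ := exists_adjoin_fieldOp_intertwine i hT
  have hv (v : List (Fin 2)) : basisVec v = prependPowers i v (Finsupp.single 0 1) := by
    simp [prependPowers]
  have hc : S (Finsupp.single 0 1) 0 = 0 := by
    rw [vacuumState_apply, hv [], hS [] (by simp), ← hv, inner_basisVec_left] at h0
    rw [← h0]
    generalize S (Finsupp.single 0 1) = ξ
    induction ξ using Finsupp.induction_linear with
    | zero => simp
    | add f g hf hg => simp [hf, hg]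
    | single n r => rcases n with - | n <;> simp [prependPowers, basisVec_apply]
  rw [hv w, hS w hw, prependPowers, Finsupp.linearCombination_apply]
  refine Submodule.sum_mem _ fun n _ => ?_
  rcases n with - | n
  · simp [hc]
  · exact Submodule.smul_mem _ _ (Submodule.subset_span ⟨List.replicate n i ++ w, by
      simp [List.replicate_succ]⟩)

/-- Applied to the vacuum from right to left, each centred factor puts its own letter in front of
words starting with a different one, so the result is orthogonal to the vacuum. -/
theorem freeElements_fieldOp : FreeElements vacuumState fieldOp := by
  intro l hl hmem hchain
  obtain ⟨⟨i, T⟩, l, rfl⟩ := List.exists_cons_of_ne_nil hl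
  have key : ∀ (l : List (Fin 2 × (FockSpace →L[ℂ] FockSpace))) (i : Fin 2)
      (T : FockSpace →L[ℂ] FockSpace),
      (∀ p ∈ (i, T) :: l, p.2 ∈ Algebra.adjoin ℂ {fieldOp p.1} ∧ vacuumState.toLin p.2 = 0) →
      ((i, T) :: l).IsChain (fun p q => p.1 ≠ q.1) →
      (((i, T) :: l).map Prod.snd).prod (basisVec []) ∈ wordsFrom i := by
    intro l
    induction l with
    | nil =>
      intro i T hmem _
      obtain ⟨h1, h2⟩ := hmem (i, T) (by simp)
      simpa using adjoin_fieldOp_basisVec_mem i h1 h2 (w := []) (by simp)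
    | cons q l ih =>
      intro i T hmem hchain
      obtain ⟨h1, h2⟩ := hmem (i, T) (by simp)
      rw [List.isChain_cons_cons] at hchain
      have h3 := ih q.1 q.2 (fun p hp => hmem p (List.mem_cons_of_mem _ hp)) hchain.2
      rw [List.map_cons, List.prod_cons, mul_apply_eq_comp]
      generalize ((q :: l).map Prod.snd).prod (basisVec []) = ξ at h3
      induction h3 using Submodule.span_induction with
      | mem ξ hξ =>
        obtain ⟨w, rfl⟩ := hξ
        exact adjoin_fieldOp_basisVec_mem i h1 h2 (by simpa using hchain.1.symm)
      | zero => simp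
      | add ξ η _ _ hξ hη => simpa using Submodule.add_mem _ hξ hη
      | smul r ξ _ hξ => simpa using Submodule.smul_mem _ r hξ
  have h := key l i T hmem hchain
  rw [vacuumState_apply]
  generalize (((i, T) :: l).map Prod.snd).prod (basisVec []) = ξ at h
  induction h using Submodule.span_induction with
  | mem ξ hξ =>
    obtain ⟨w, rfl⟩ := hξ
    simp [inner_basisVec]
  | zero => simp
  | add ξ η _ _ hξ hη => rw [inner_add_right, hξ, hη, add_zero]
  | smul r ξ _ hξ => rw [inner_smul_right, hξ, mul_zero]

end FockSpace

end

/-! ### The `*`-moments of the circular element as stack counts. -/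

/-- The number of ways to read a word of letters, at each step either pushing the letter onto the
stack or cancelling it against the opposite letter on top, so that the stack ends up empty. -/
def stackCount : List Bool → List Bool → ℕ
  | s, [] => if s = [] then 1 else 0
  | s, ε :: w => stackCount (ε :: s) w + if s.head? = some (!ε) then stackCount s.tail w else 0

noncomputable section

namespace FockSpace

/-- The circular element built from the two field operators. -/
def circularOp : FockSpace →L[ℂ] FockSpace :=
  ((Real.sqrt 2 : ℝ) : ℂ)⁻¹ • (fieldOp 0 + Complex.I • fieldOp 1)

theorem isCircular_circularOp : IsCircular vacuumState circularOp :=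
  ⟨fieldOp, isSemicircular_fieldOp, freeElements_fieldOp, rfl⟩

/-- The circular element or its adjoint. -/
def circularLetter (ε : Bool) : FockSpace →L[ℂ] FockSpace :=
  if ε then star circularOp else circularOp

/-- The scalar `i` or `-i`. -/
def letterScalar (ε : Bool) : ℂ := if ε then Complex.I else -Complex.I

theorem star_circularLetter (ε : Bool) : star (circularLetter ε) = circularLetter (!ε) := by
  cases ε <;> simp [circularLetter]

/-- The creation operators of the orthonormal basis of `ℂ²` adapted to the circular element. -/
def chiralCreation (ε : Bool) : FockSpace →L[ℂ] FockSpace :=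
  ((Real.sqrt 2 : ℝ) : ℂ)⁻¹ • (creation 0 + letterScalar ε • creation 1)

theorem star_letterScalar (ε : Bool) : star (letterScalar ε) = letterScalar (!ε) := by
  cases ε <;> simp [letterScalar]

theorem star_inv_sqrt_two : star (((Real.sqrt 2 : ℝ) : ℂ)⁻¹) = ((Real.sqrt 2 : ℝ) : ℂ)⁻¹ := by
  rw [star_inv₀]
  congr 1
  exact Complex.conj_ofReal _

/-- In the rotated basis each letter is one creation plus one annihilation operator, with opposite
labels: a push or a pop. The adjoint appears because operators are later moved to the left vector.
-/
theorem star_circularLetter_eq (ε : Bool) :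
    star (circularLetter ε) = chiralCreation ε + star (chiralCreation (!ε)) := by
  rw [star_circularLetter]
  have h : circularLetter (!ε) =
      ((Real.sqrt 2 : ℝ) : ℂ)⁻¹ • (fieldOp 0 + letterScalar ε • fieldOp 1) := by
    cases ε
    · simp [circularLetter, circularOp, letterScalar, star_smul, star_add, Complex.conj_ofReal,
        (isSelfAdjoint_fieldOp _).star_eq]
    · simp [circularLetter, circularOp, letterScalar]
  rw [h, chiralCreation, chiralCreation, star_smul, star_add, star_smul, star_letterScalar,
    star_inv_sqrt_two, Bool.not_not, fieldOp, fieldOp]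
  module

theorem star_creation_mul_creation (i j : Fin 2) :
    star (creation i) * creation j = if i = j then 1 else 0 := by
  ext ξ w
  rw [← inner_basisVec_left, mul_apply_eq_comp, ContinuousLinearMap.star_eq_adjoint,
    ContinuousLinearMap.adjoint_inner_right, creation_basisVec,
    ← ContinuousLinearMap.adjoint_inner_left, ← ContinuousLinearMap.star_eq_adjoint,
    star_creation_basisVec]
  by_cases h : i = j
  · simp [h, inner_basisVec_left]
  · simp [h]

theorem star_chiralCreation_mul (ε η : Bool) :
    star (chiralCreation ε) * chiralCreation η = if ε = η then 1 else 0 := by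
  have h2 : ((Real.sqrt 2 : ℝ) : ℂ)⁻¹ * ((Real.sqrt 2 : ℝ) : ℂ)⁻¹ = 1 / 2 := by
    rw [← mul_inv, ← Complex.ofReal_mul, Real.mul_self_sqrt (by norm_num)]
    norm_num
  have h3 : star (chiralCreation ε) * chiralCreation η =
      ((1 + letterScalar (!ε) * letterScalar η) / 2) • (1 : FockSpace →L[ℂ] FockSpace) := by
    rw [chiralCreation, chiralCreation, star_smul, star_add, star_smul, star_letterScalar,
      star_inv_sqrt_two, smul_mul_smul_comm, h2, add_mul, mul_add, mul_add]
    simp only [smul_mul_assoc, mul_smul_comm, star_creation_mul_creation]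
    simp
    module
  rw [h3]
  cases ε <;> cases η <;> simp [letterScalar]

theorem star_chiralCreation_vacuum (ε : Bool) : star (chiralCreation ε) (basisVec []) = 0 := by
  simp [chiralCreation, star_smul, star_add, star_creation_basisVec]

/-- The vector obtained from the vacuum by applying the chiral creation operators of a word. -/
def chiralVec : List Bool → FockSpace
  | [] => basisVec []
  | ε :: s => chiralCreation ε (chiralVec s)

theorem star_circularLetter_chiralVec (ε : Bool) (s : List Bool) :
    star (circularLetter ε) (chiralVec s) =
      chiralVec (ε :: s) + if s.head? = some (!ε) then chiralVec s.tail else 0 := by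
  rw [star_circularLetter_eq, add_apply]
  congr 1
  rcases s with - | ⟨η, s⟩
  · simp [chiralVec, star_chiralCreation_vacuum]
  · rw [chiralVec, ← mul_apply_eq_comp, star_chiralCreation_mul]
    by_cases h : η = !ε
    · simp [h]
    · simp [h, Ne.symm h]

theorem inner_vacuum_chiralVec (s : List Bool) :
    inner ℂ (chiralVec s) (basisVec []) = if s = [] then (1 : ℂ) else 0 := by
  rcases s with - | ⟨ε, s⟩
  · simp only [chiralVec, inner_basisVec, if_true]
  · rw [chiralVec, ← ContinuousLinearMap.adjoint_inner_right, ← ContinuousLinearMap.star_eq_adjoint,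
      star_chiralCreation_vacuum]
    simp

theorem inner_chiralVec_prod (s w : List Bool) :
    inner ℂ (chiralVec s) ((w.map circularLetter).prod (basisVec [])) =
      (stackCount s w : ℂ) := by
  induction w generalizing s with
  | nil =>
    rw [List.map_nil, List.prod_nil, one_apply_eq_self, inner_vacuum_chiralVec, stackCount]
    split_ifs <;> simp
  | cons ε w ih =>
    rw [List.map_cons, List.prod_cons, mul_apply_eq_comp, ← ContinuousLinearMap.adjoint_inner_left,
      ← ContinuousLinearMap.star_eq_adjoint, star_circularLetter_chiralVec, inner_add_left, ih,
      stackCount]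
    split_ifs
    · rw [ih, Nat.cast_add]
    · simp

theorem vacuumState_prod_circularLetter (w : List Bool) :
    vacuumState.toLin (w.map circularLetter).prod = (stackCount [] w : ℂ) :=
  inner_chiralVec_prod [] w

end FockSpace

end

/-! ### Edge labels, pairings and representatives of vertices. -/

/-- The coefficient of the source vertex in the label of an edge traversed forwards (`false`) or
backwards (`true`). -/
def letterCoeff (a b : ℤ) (ε : Bool) : ℤ := if ε then b else a

theorem letterCoeff_ne_zero {a b : ℤ} (ha : a ≠ 0) (hb : b ≠ 0) (ε : Bool) :
    letterCoeff a b ε ≠ 0 := by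
  cases ε <;> simpa [letterCoeff]

theorem letterCoeff_det {a b c d : ℤ} (h : a * d - b * c ≠ 0) (ε : Bool) :
    letterCoeff a b ε * letterCoeff d c ε - letterCoeff b a ε * letterCoeff c d ε ≠ 0 := by
  cases ε
  · simpa [letterCoeff] using h
  · intro h'
    apply h
    simp only [letterCoeff, if_true] at h'
    linarith

/-- The linear form `a r + b c` at the `k`-th edge `(r, c)` of the path `z`. -/
def edgeLabel (a b : ℤ) (ε : ℕ → Bool) (z : ℕ → ℤ) (k : ℕ) : ℤ :=
  letterCoeff a b (ε k) * z k + letterCoeff b a (ε k) * z (k + 1)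

theorem edgeLabel_sub (a b : ℤ) (ε : ℕ → Bool) (z z' : ℕ → ℤ) (k : ℕ) :
    edgeLabel a b ε (z - z') k = edgeLabel a b ε z k - edgeLabel a b ε z' k := by
  simp only [edgeLabel, Pi.sub_apply]
  ring

/-- For opposite letters the two label equations form a linear system in the differences of
corresponding end points, with determinant `a * d - b * c`. -/
theorem eq_reverse_of_edgeLabel_eq {a b c d : ℤ} (h : a * d - b * c ≠ 0) {ε : ℕ → Bool}
    {z : ℕ → ℤ} {k t : ℕ} (hε : ε k = !ε t) (h1 : edgeLabel a b ε z k = edgeLabel a b ε z t)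
    (h2 : edgeLabel c d ε z k = edgeLabel c d ε z t) : z (k + 1) = z t ∧ z k = z (t + 1) := by
  have key : ∀ x y : ℤ, a * x + b * y = 0 → c * x + d * y = 0 → x = 0 ∧ y = 0 := by
    intro x y hx hy
    constructor
    · refine (mul_eq_zero.1 (?_ : (a * d - b * c) * x = 0)).resolve_left h
      linear_combination d * hx - b * hy
    · refine (mul_eq_zero.1 (?_ : (a * d - b * c) * y = 0)).resolve_left h
      linear_combination a * hy - c * hx
  simp only [edgeLabel, hε, letterCoeff] at h1 h2
  cases ht : ε t
  · simp only [ht, Bool.not_false, if_true, Bool.false_eq_true, if_false] at h1 h2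
    have := key (z (k + 1) - z t) (z k - z (t + 1)) (by linarith) (by linarith)
    constructor <;> omega
  · simp only [ht, Bool.not_true, if_true, Bool.false_eq_true, if_false] at h1 h2
    have := key (z k - z (t + 1)) (z (k + 1) - z t) (by linarith) (by linarith)
    constructor <;> omega

/-- A pairing of `{0, …, m - 1}`: the positions in `O` are the first elements of their pairs, and
`p` maps every other position to its partner. -/
structure IsOpenerPairing (m : ℕ) (O : ℕ → Prop) (p : ℕ → ℕ) : Prop where
  lt : ∀ k < m, ¬ O k → p k < k
  opener : ∀ k < m, ¬ O k → O (p k)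
  inj : ∀ k < m, ∀ k' < m, ¬ O k → ¬ O k' → p k = p k' → k = k'
  surj : ∀ t < m, O t → ∃ k < m, ¬ O k ∧ p k = t

open Classical in
/-- The vertex with which the `κ`-th vertex of a path is identified when every closing edge is the
reverse of its partner. -/
noncomputable def vertexRep (O : ℕ → Prop) (p : ℕ → ℕ) : ℕ → ℕ
  | 0 => 0
  | κ + 1 => if O κ then κ + 1 else if _ : p κ < κ + 1 then vertexRep O p (p κ) else 0

/-- No pair that closes before `K` has an element of an unclosed pair between its two elements. -/
def IsNestedBefore (O : ℕ → Prop) (p : ℕ → ℕ) (K : ℕ) : Prop :=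
  ∀ k < K, ¬ O k → ∀ t, O t → p k < t → t < k → ∃ k' < k, ¬ O k' ∧ p k' = t

namespace IsOpenerPairing

variable {m : ℕ} {O : ℕ → Prop} {p : ℕ → ℕ}

theorem vertexRep_opener {κ : ℕ} (h : O κ) : vertexRep O p (κ + 1) = κ + 1 := by
  rw [vertexRep, if_pos h]

theorem vertexRep_closer (hp : IsOpenerPairing m O p) {κ : ℕ} (hκ : κ < m) (h : ¬ O κ) :
    vertexRep O p (κ + 1) = vertexRep O p (p κ) := by
  rw [vertexRep, if_neg h, dif_pos (by have := hp.lt κ hκ h; omega)]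

theorem vertexRep_cases (hp : IsOpenerPairing m O p) (κ : ℕ) (hκ : κ ≤ m) :
    vertexRep O p κ = 0 ∨ ∃ s < κ, O s ∧ vertexRep O p κ = s + 1 := by
  induction κ using Nat.strong_induction_on with
  | _ κ ih =>
    rcases κ with - | κ
    · left; rw [vertexRep]
    · by_cases h : O κ
      · exact Or.inr ⟨κ, by omega, h, vertexRep_opener h⟩
      · have hlt := hp.lt κ hκ h
        rw [hp.vertexRep_closer hκ h]
        rcases ih (p κ) (by omega) (by omega) with h0 | ⟨s, hs, hO, hs'⟩
        · exact Or.inl h0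
        · exact Or.inr ⟨s, by omega, hO, hs'⟩

theorem vertexRep_le (hp : IsOpenerPairing m O p) {κ : ℕ} (hκ : κ ≤ m) : vertexRep O p κ ≤ κ := by
  rcases hp.vertexRep_cases κ hκ with h | ⟨s, hs, -, h⟩ <;> omega

/-- A closing edge returns to the source of its partner. By nesting, an edge that is still open
cannot lie after that partner, so the return never goes behind the end of an open edge. -/
theorem le_vertexRep_of_unclosed (hp : IsOpenerPairing m O p) {K : ℕ} (hK : K ≤ m)
    (hN : IsNestedBefore O p K) (κ : ℕ) (hκ : κ ≤ K) (t : ℕ) (ht : t < κ) (hO : O t)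
    (hopen : ∀ k' < κ, ¬ O k' → p k' ≠ t) : t + 1 ≤ vertexRep O p κ := by
  induction κ using Nat.strong_induction_on with
  | _ κ ih =>
    rcases κ with - | κ
    · omega
    · by_cases h : O κ
      · rw [vertexRep_opener h]
        exact ht
      · have hlt := hp.lt κ (by omega) h
        have hne := hopen κ (by omega) h
        have htκ : t ≠ κ := fun e => h (e ▸ hO)
        rw [hp.vertexRep_closer (by omega) h]
        refine ih (p κ) (by omega) (by omega) ?_ fun k' hk' => hopen k' (by omega)
        by_contra hcon
        obtain ⟨k', hk', hO', e⟩ := hN κ (by omega) h t hO (by omega) (by omega)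
        exact hopen k' (by omega) hO' e

/-- If the path returns over `p κ` to the end of edge `s`, then `s` cannot have been closed in
between: `p κ` would be an open edge inside a closed pair. -/
theorem unclosed_of_vertexRep_eq (hp : IsOpenerPairing m O p) {K : ℕ} (hK : K ≤ m)
    (hN : IsNestedBefore O p K) (κ : ℕ) (hκ : κ ≤ K) (s : ℕ) (hs : vertexRep O p κ = s + 1) :
    ∀ k' < κ, ¬ O k' → p k' ≠ s := by
  induction κ using Nat.strong_induction_on with
  | _ κ ih =>
    rcases κ with - | κ
    · rw [vertexRep] at hs
      omega
    · intro k' hk' hO' e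
      have hlt' := hp.lt k' (by omega) hO'
      by_cases h : O κ
      · rw [vertexRep_opener h] at hs
        omega
      · have hlt := hp.lt κ (by omega) h
        have hop := hp.opener κ (by omega) h
        rw [hp.vertexRep_closer (by omega) h] at hs
        have hle := hp.vertexRep_le (κ := p κ) (by omega)
        by_cases h1 : k' < p κ
        · exact ih (p κ) (by omega) (by omega) hs k' h1 hO' e
        have h2 : k' ≠ p κ := fun e' => hO' (e' ▸ hop)
        obtain ⟨k'', hk'', hO'', e''⟩ :=
          hN k' (by omega) hO' (p κ) hop (by omega) (by omega)
        have := hp.inj k'' (by omega) κ (by omega) hO'' h e''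
        omega

/-- The two preceding bounds locate the path, just before a closing edge, at the end of the last
open edge, which is the partner. -/
theorem vertexRep_partner (hp : IsOpenerPairing m O p) {K : ℕ} (hK : K < m)
    (hN : IsNestedBefore O p (K + 1)) (hO : ¬ O K) : vertexRep O p K = p K + 1 := by
  have hlt := hp.lt K hK hO
  have h1 := hp.le_vertexRep_of_unclosed (Nat.succ_le_of_lt hK) hN K (by omega) (p K) hlt
    (hp.opener K hK hO) (fun k' hk' hO' e => by
      have := hp.inj k' (by omega) K hK hO' hO e
      omega)
  rcases hp.vertexRep_cases K hK.le with h0 | ⟨s, hs, hOs, hs'⟩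
  · omega
  · by_contra hne
    obtain ⟨k', hk', hO', e⟩ := hN K (by omega) hO s hOs (by omega) (by omega)
    exact hp.unclosed_of_vertexRep_eq (Nat.succ_le_of_lt hK) hN K (by omega) s hs' k' hk' hO' e

theorem vertexRep_last (hp : IsOpenerPairing m O p) (hN : IsNestedBefore O p m) :
    vertexRep O p m = 0 := by
  rcases hp.vertexRep_cases m le_rfl with h0 | ⟨s, hs, hOs, hs'⟩
  · exact h0
  · obtain ⟨k, hk, hO, e⟩ := hp.surj s hs hOs
    exact absurd e (hp.unclosed_of_vertexRep_eq le_rfl hN m le_rfl s hs' k hk hO)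

end IsOpenerPairing

/-! ### Test vectors force non-crossing reversals. -/

/-- The free vertices: the initial vertex and the end points of the opening edges. -/
def IsFreeVertex (m : ℕ) (O : ℕ → Prop) (f : ℕ) : Prop := f = 0 ∨ ∃ t < m, O t ∧ f = t + 1

/-- The paths whose closing edges carry the same labels as their partners. -/
def IsLabelCompatible (a b c d : ℤ) (ε : ℕ → Bool) (m : ℕ) (O : ℕ → Prop) (p q : ℕ → ℕ)
    (z : ℕ → ℤ) : Prop :=
  ∀ k < m, ¬ O k → edgeLabel a b ε z k = edgeLabel a b ε z (p k) ∧
    edgeLabel c d ε z k = edgeLabel c d ε z (q k)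

/-- The closing edge `k` is the reverse of its partner, which is the last unclosed edge. -/
def IsReversalAt (ε : ℕ → Bool) (O : ℕ → Prop) (p q : ℕ → ℕ) (k : ℕ) : Prop :=
  p k = q k ∧ ε k = (!ε (p k)) ∧ ∀ t, O t → p k < t → t < k → ∃ k' < k, ¬ O k' ∧ p k' = t

section

variable {a b c d : ℤ} {ε : ℕ → Bool} {m : ℕ} {O : ℕ → Prop} {p q : ℕ → ℕ}

theorem apply_vertexRep (hdet : a * d - b * c ≠ 0) (hp : IsOpenerPairing m O p) {K : ℕ}
    (hK : K ≤ m) (hR : ∀ k < K, ¬ O k → IsReversalAt ε O p q k) {z : ℕ → ℤ}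
    (hz : IsLabelCompatible a b c d ε m O p q z) (κ : ℕ) (hκ : κ ≤ K) :
    z (vertexRep O p κ) = z κ := by
  induction κ using Nat.strong_induction_on with
  | _ κ ih =>
    rcases κ with - | κ
    · rw [vertexRep]
    · by_cases h : O κ
      · rw [IsOpenerPairing.vertexRep_opener h]
      · have hlt := hp.lt κ (by omega) h
        obtain ⟨e1, e2, -⟩ := hR κ (by omega) h
        obtain ⟨l1, l2⟩ := hz κ (by omega) h
        rw [← e1] at l2
        rw [hp.vertexRep_closer (by omega) h, ih (p κ) (by omega) (by omega),
          (eq_reverse_of_edgeLabel_eq hdet e2 l1 l2).1]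

theorem vertexRep_isFree (hp : IsOpenerPairing m O p) {κ : ℕ} (hκ : κ ≤ m) :
    IsFreeVertex m O (vertexRep O p κ) := by
  rcases hp.vertexRep_cases κ hκ with h | ⟨s, hs, hO, h⟩
  · exact Or.inl h
  · exact Or.inr ⟨s, by omega, hO, h⟩

/-- Induction on the closing edge: if all earlier closing edges are reversals, the values of a
compatible path up to `k` are values at free vertices, so a test vector is known explicitly on every
edge that matters at `k`. -/
theorem isReversalAt_of_tests (ha : a ≠ 0) (hb : b ≠ 0) (hc : c ≠ 0) (hd : d ≠ 0)
    (hdet : a * d - b * c ≠ 0) (hp : IsOpenerPairing m O p) (hq : IsOpenerPairing m O q)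
    (htest : ∀ f, IsFreeVertex m O f → ∃ z, IsLabelCompatible a b c d ε m O p q z ∧ z f ≠ 0 ∧
      ∀ f', IsFreeVertex m O f' → f' ≠ f → z f' = 0)
    (k : ℕ) (hk : k < m) (hO : ¬ O k) : IsReversalAt ε O p q k := by
  induction k using Nat.strong_induction_on with
  | _ k ih =>
    have hR : ∀ j < k, ¬ O j → IsReversalAt ε O p q j := fun j hj hOj => ih j hj (by omega) hOj
    have hN : IsNestedBefore O p k := fun j hj hOj => (hR j hj hOj).2.2
    have hrep : ∀ z, IsLabelCompatible a b c d ε m O p q z → ∀ κ ≤ k,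
        z (vertexRep O p κ) = z κ := fun z hz => apply_vertexRep hdet hp hk.le hR hz
    have hpk := hp.lt k hk hO
    have hqk := hq.lt k hk hO
    have hpO := hp.opener k hk hO
    have hqO := hq.opener k hk hO
    have hfree : ∀ t < m, O t → IsFreeVertex m O (t + 1) := fun t ht hOt =>
      Or.inr ⟨t, ht, hOt, rfl⟩
    have hopen_p : ∀ k' < k, ¬ O k' → p k' ≠ p k := fun k' hk' hO' e => by
      have := hp.inj k' (by omega) k hk hO' hO e
      omega
    have hopen_q : ∀ k' < k, ¬ O k' → p k' ≠ q k := fun k' hk' hO' e => by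
      have := hq.inj k' (by omega) k hk hO' hO ((hR k' hk' hO').1.symm.trans e)
      omega
    have hunc : ∀ κ ≤ k, ∀ t < κ, O t → (∀ k' < k, ¬ O k' → p k' ≠ t) →
        t + 1 ≤ vertexRep O p κ := fun κ hκ t ht hOt h =>
      hp.le_vertexRep_of_unclosed hk.le hN κ hκ t ht hOt fun k' hk' => h k' (by omega)
    -- the test path supported at the initial vertex of an open edge
    have hsrc : ∀ t < k, O t → (∀ k' < k, ¬ O k' → p k' ≠ t) →
        ∃ z, IsLabelCompatible a b c d ε m O p q z ∧ z t ≠ 0 ∧ z (t + 1) = 0 ∧ z k = 0 ∧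
          ∀ t' < k, O t' → t < t' → z t' = 0 ∧ z (t' + 1) = 0 := by
      intro t ht hOt hopen
      have hle := hp.vertexRep_le (κ := t) (by omega)
      obtain ⟨z, hz, hne, h0⟩ := htest (vertexRep O p t) (vertexRep_isFree hp (by omega))
      refine ⟨z, hz, ?_, h0 _ (hfree t (by omega) hOt) (by omega), ?_, fun t' ht' hOt' hlt => ?_⟩
      · rwa [hrep z hz t ht.le] at hne
      · have := hunc k le_rfl t ht hOt hopen
        rw [← hrep z hz k le_rfl]
        exact h0 _ (vertexRep_isFree hp hk.le) (by omega)
      · have := hunc t' ht'.le t hlt hOt hopen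
        rw [← hrep z hz t' ht'.le]
        exact ⟨h0 _ (vertexRep_isFree hp (by omega)) (by omega),
          h0 _ (hfree t' (by omega) hOt') (by omega)⟩
    -- Test at the source of the earlier of the two partners. The later one then has both labels
    -- zero, which forces the end point of `k` to vanish and contradicts the other label equation.
    have hpq : p k = q k := by
      rcases lt_trichotomy (p k) (q k) with hlt | h | hlt
      · exfalso
        obtain ⟨z, hz, h1, h2, h3, h4⟩ := hsrc (p k) hpk hpO hopen_p
        obtain ⟨h5, h6⟩ := h4 (q k) hqk hqO hlt
        obtain ⟨l1, l2⟩ := hz k hk hO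
        simp only [edgeLabel, h2, h3, h5, h6, mul_zero, zero_add, add_zero] at l1 l2
        have h7 := (mul_eq_zero.1 l2).resolve_left (letterCoeff_ne_zero hd hc _)
        rw [h7, mul_zero] at l1
        exact h1 ((mul_eq_zero.1 l1.symm).resolve_left (letterCoeff_ne_zero ha hb _))
      · exact h
      · exfalso
        obtain ⟨z, hz, h1, h2, h3, h4⟩ := hsrc (q k) hqk hqO hopen_q
        obtain ⟨h5, h6⟩ := h4 (p k) hpk hpO hlt
        obtain ⟨l1, l2⟩ := hz k hk hO
        simp only [edgeLabel, h2, h3, h5, h6, mul_zero, zero_add, add_zero] at l1 l2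
        have h7 := (mul_eq_zero.1 l1).resolve_left (letterCoeff_ne_zero hb ha _)
        rw [h7, mul_zero] at l2
        exact h1 ((mul_eq_zero.1 l2.symm).resolve_left (letterCoeff_ne_zero hc hd _))
    obtain ⟨z, hz, h1, h2, h3, -⟩ := hsrc (p k) hpk hpO hopen_p
    obtain ⟨l1, l2⟩ := hz k hk hO
    rw [← hpq] at l2
    simp only [edgeLabel, h2, h3, mul_zero, zero_add, add_zero] at l1 l2
    have hz1 : z (k + 1) ≠ 0 := by
      intro h7
      rw [h7, mul_zero] at l1
      exact h1 ((mul_eq_zero.1 l1.symm).resolve_left (letterCoeff_ne_zero ha hb _))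
    -- Eliminating `z (p k)` and `z (k + 1)`: the source coefficients of the partner are
    -- proportional to the target coefficients of `k`. With equal letters this would be `a * d - b *
    -- c = 0`.
    have hsource : letterCoeff a b (ε (p k)) * letterCoeff d c (ε k) =
        letterCoeff c d (ε (p k)) * letterCoeff b a (ε k) := by
      refine mul_right_cancel₀ (mul_ne_zero h1 hz1) ?_
      linear_combination (-letterCoeff d c (ε k) * z (k + 1)) * l1 +
        (letterCoeff b a (ε k) * z (k + 1)) * l2
    refine ⟨hpq, ?_, fun t hOt hlt htk => ?_⟩
    · by_contra hne
      have he : ε (p k) = ε k := by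
        cases h : ε k <;> cases h' : ε (p k) <;> simp_all
      rw [he] at hsource
      exact letterCoeff_det hdet (ε k) (by linear_combination hsource)
    · by_contra hcon
      -- An open edge between the two would separate `k` from the target of its partner. Testing at
      -- that target makes the target coefficients proportional too, so source and target
      -- coefficients of the partner become proportional to each other, against the determinant.
      push Not at hcon
      have h8 := hunc k le_rfl t htk hOt hcon
      have hle := hp.vertexRep_le (κ := p k) (by omega)
      obtain ⟨y, hy, y1, y0⟩ := htest (p k + 1) (hfree _ (by omega) hpO)
      have y2 : y (p k) = 0 := by
        rw [← hrep y hy (p k) hpk.le]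
        exact y0 _ (vertexRep_isFree hp (by omega)) (by omega)
      have y3 : y k = 0 := by
        rw [← hrep y hy k le_rfl]
        exact y0 _ (vertexRep_isFree hp hk.le) (by omega)
      obtain ⟨m1, m2⟩ := hy k hk hO
      rw [← hpq] at m2
      simp only [edgeLabel, y2, y3, mul_zero, zero_add] at m1 m2
      have hy1 : y (k + 1) ≠ 0 := by
        intro h7
        rw [h7, mul_zero] at m1
        exact y1 ((mul_eq_zero.1 m1.symm).resolve_left (letterCoeff_ne_zero hb ha _))
      have htarget : letterCoeff b a (ε (p k)) * letterCoeff d c (ε k) =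
          letterCoeff d c (ε (p k)) * letterCoeff b a (ε k) := by
        refine mul_right_cancel₀ (mul_ne_zero y1 hy1) ?_
        linear_combination (-letterCoeff d c (ε k) * y (k + 1)) * m1 +
          (letterCoeff b a (ε k) * y (k + 1)) * m2
      refine letterCoeff_det hdet (ε (p k)) (mul_right_cancel₀
        (mul_ne_zero (letterCoeff_ne_zero hb ha (ε k)) (letterCoeff_ne_zero hd hc (ε k))) ?_)
      linear_combination (letterCoeff d c (ε (p k)) * letterCoeff b a (ε k)) * hsource -
        (letterCoeff c d (ε (p k)) * letterCoeff b a (ε k)) * htarget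

end

/-! ### Cancelling paths on a stack of edges. -/

section PathStack

variable {V : Type*} [DecidableEq V]

/-- Traversing an edge from `u` to `v` with letter `ε` cancels the top of the stack if that records
the same edge traversed from `v` to `u` with the opposite letter, and is recorded otherwise. -/
def stackStep (s : List (Bool × V)) (ε : Bool) (u v : V) : List (Bool × V) :=
  if s.head? = some (!ε, v) then s.tail else (ε, u) :: s

/-- The stack after the first `k` edges of the path `v`, starting from the stack `s`. -/
def pathStack (ε : ℕ → Bool) (v : ℕ → V) (s : List (Bool × V)) : ℕ → List (Bool × V)
  | 0 => s
  | k + 1 => stackStep (pathStack ε v s k) (ε k) (v k) (v (k + 1))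

theorem pathStack_succ_left (ε : ℕ → Bool) (v : ℕ → V) (s : List (Bool × V)) (k : ℕ) :
    pathStack ε v s (k + 1) =
      pathStack (fun j => ε (j + 1)) (fun j => v (j + 1)) (stackStep s (ε 0) (v 0) (v 1)) k := by
  induction k with
  | zero => rfl
  | succ k ih => rw [pathStack, ih]; rfl

/-- The vertex at which the path recorded by a stack begins. -/
def stackBase : List (Bool × V) → V → V
  | [], u => u
  | (_, u₀) :: s, _ => stackBase s u₀

theorem stackBase_cons {V : Type*} (e : Bool) (u₀ u : V) (s : List (Bool × V)) :
    stackBase ((e, u₀) :: s) u = stackBase s u₀ := rfl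

theorem stackBase_stackStep (s : List (Bool × V)) (ε : Bool) (u v : V) :
    stackBase (stackStep s ε u v) v = stackBase s u := by
  rw [stackStep]
  split_ifs with h
  · rcases s with - | ⟨⟨e, u₀⟩, s⟩
    · simp at h
    · simp only [List.head?_cons, Option.some.injEq, Prod.mk.injEq] at h
      rw [List.tail_cons, stackBase_cons, h.2]
  · rfl

theorem stackBase_pathStack (ε : ℕ → Bool) (v : ℕ → V) (s : List (Bool × V)) (k : ℕ) :
    stackBase (pathStack ε v s k) (v k) = stackBase s (v 0) := by
  induction k with
  | zero => rfl
  | succ k ih => rw [pathStack, stackBase_stackStep, ih]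

/-- A path whose stack is cleared is closed. -/
theorem eq_of_pathStack_eq_nil {ε : ℕ → Bool} {v : ℕ → V} {m : ℕ}
    (h : pathStack ε v [] m = []) : v m = v 0 := by
  have := stackBase_pathStack ε v [] m
  rwa [h] at this

/-- The sum of the weights of the edges recorded by a stack. -/
def stackWeight (φ : Bool → V → V → ℤ) : List (Bool × V) → V → ℤ
  | [], _ => 0
  | (e, u₀) :: s, u => φ e u₀ u + stackWeight φ s u₀

theorem stackWeight_stackStep {φ : Bool → V → V → ℤ} (hφ : ∀ e u v, φ (!e) v u = -φ e u v)
    (s : List (Bool × V)) (ε : Bool) (u v : V) :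
    stackWeight φ (stackStep s ε u v) v = stackWeight φ s u + φ ε u v := by
  rw [stackStep]
  split_ifs with h
  · rcases s with - | ⟨⟨e, u₀⟩, s⟩
    · simp at h
    · simp only [List.head?_cons, Option.some.injEq, Prod.mk.injEq] at h
      obtain ⟨rfl, rfl⟩ := h
      rw [List.tail_cons, stackWeight, hφ]
      ring
  · rw [stackWeight, add_comm]

theorem stackWeight_pathStack {φ : Bool → V → V → ℤ} (hφ : ∀ e u v, φ (!e) v u = -φ e u v)
    (ε : ℕ → Bool) (v : ℕ → V) (k : ℕ) :
    stackWeight φ (pathStack ε v [] k) (v k) =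
      ∑ j ∈ Finset.range k, φ (ε j) (v j) (v (j + 1)) := by
  induction k with
  | zero => rfl
  | succ k ih => rw [pathStack, stackWeight_stackStep hφ, ih, Finset.sum_range_succ]

/-- If the stack is cleared, every antisymmetric edge weight sums to zero. -/
theorem sum_eq_zero_of_pathStack_eq_nil {φ : Bool → V → V → ℤ}
    (hφ : ∀ e u v, φ (!e) v u = -φ e u v) {ε : ℕ → Bool} {v : ℕ → V} {m : ℕ}
    (h : pathStack ε v [] m = []) : ∑ j ∈ Finset.range m, φ (ε j) (v j) (v (j + 1)) = 0 := by
  rw [← stackWeight_pathStack hφ, h, stackWeight]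

/-- The stack depends only on the representative of the current vertex: an opener pushes, since
`hfresh` forbids cancellation, and a closing edge finds its partner on top. All edges being closed,
the last representative is the initial vertex, with empty stack. -/
theorem pathStack_eq_nil_of_isReversalAt {ε : ℕ → Bool} {v : ℕ → V} {m : ℕ} {O : ℕ → Prop}
    {p q : ℕ → ℕ} (hp : IsOpenerPairing m O p)
    (hR : ∀ k < m, ¬ O k → IsReversalAt ε O p q k)
    (hrev : ∀ k < m, ¬ O k → v (k + 1) = v (p k) ∧ v k = v (p k + 1))
    (hfresh : ∀ t < m, O t → ∀ s < t, ε s = (!ε t) → v s = v (t + 1) → v (s + 1) ≠ v t) :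
    pathStack ε v [] m = [] := by
  have hN : ∀ K ≤ m, IsNestedBefore O p K := fun K hK j hj hOj => (hR j (by omega) hOj).2.2
  have key : ∀ κ ≤ m, pathStack ε v [] κ = pathStack ε v [] (vertexRep O p κ) ∧
      v κ = v (vertexRep O p κ) ∧
      ∀ t, κ = t + 1 → O t → pathStack ε v [] κ = (ε t, v t) :: pathStack ε v [] t := by
    intro κ
    induction κ using Nat.strong_induction_on with
    | _ κ ih =>
      intro hκ
      rcases κ with - | κ
      · rw [vertexRep]
        exact ⟨rfl, rfl, fun t ht => by omega⟩
      · by_cases h : O κ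
        · rw [IsOpenerPairing.vertexRep_opener h]
          refine ⟨rfl, rfl, fun t ht _ => ?_⟩
          obtain rfl : κ = t := by omega
          rw [pathStack, stackStep, if_neg]
          intro hhead
          obtain ⟨h1, h2, -⟩ := ih κ (by omega) (by omega)
          rcases hp.vertexRep_cases κ (by omega) with h0 | ⟨s, hs, hOs, hs'⟩
          · rw [h1, h0, pathStack] at hhead
            simp at hhead
          · rw [hs'] at h1 h2
            rw [h1, (ih (s + 1) (by omega) (by omega)).2.2 s rfl hOs] at hhead
            simp only [List.head?_cons, Option.some.injEq, Prod.mk.injEq] at hhead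
            exact hfresh κ (by omega) h s hs hhead.1 hhead.2 h2.symm
        · have hlt := hp.lt κ (by omega) h
          obtain ⟨e1, e2, -⟩ := hR κ (by omega) h
          obtain ⟨r1, r2⟩ := hrev κ (by omega) h
          obtain ⟨i1, i2, -⟩ := ih (p κ) (by omega) (by omega)
          have hstack : pathStack ε v [] (κ + 1) = pathStack ε v [] (p κ) := by
            rw [pathStack, (ih κ (by omega) (by omega)).1,
              hp.vertexRep_partner (by omega) (hN (κ + 1) hκ) h,
              (ih (p κ + 1) (by omega) (by omega)).2.2 (p κ) rfl (hp.opener κ (by omega) h),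
              stackStep, if_pos, List.tail_cons]
            rw [List.head?_cons, e2, r1, Bool.not_not]
          refine ⟨?_, ?_, fun t ht hO => ?_⟩
          · rw [hp.vertexRep_closer (by omega) h, hstack, i1]
          · rw [hp.vertexRep_closer (by omega) h, r1, i2]
          · obtain rfl : κ = t := by omega
            exact absurd hO h
  rw [(key m le_rfl).1, hp.vertexRep_last (hN m le_rfl), pathStack]

end PathStack

/-! ### Traces as sums over paths, and the number of clearing paths. -/

/-- Extension of a finite path to all times, constant after its end. -/
def extendPath {V : Type*} {m : ℕ} (v : Fin (m + 1) → V) (k : ℕ) : V :=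
  v ⟨min k m, by omega⟩

theorem extendPath_cons_zero {V : Type*} {m : ℕ} (u : V) (v : Fin m → V) :
    extendPath (Fin.cons u v : Fin (m + 1) → V) 0 = u := by
  simp [extendPath]

theorem extendPath_cons_succ {V : Type*} {m : ℕ} (u : V) (v : Fin (m + 1) → V) (k : ℕ) :
    extendPath (Fin.cons u v : Fin (m + 2) → V) (k + 1) = extendPath v k := by
  have h : (⟨min (k + 1) (m + 1), by omega⟩ : Fin (m + 2)) =
      Fin.succ ⟨min k m, by omega⟩ := by
    ext
    simp
  rw [extendPath, h, Fin.cons_succ, extendPath]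

theorem sum_fin_cons {V M : Type*} [Fintype V] [AddCommMonoid M] {m : ℕ}
    (F : (Fin (m + 1) → V) → M) :
    ∑ v, F v = ∑ u : V, ∑ v : Fin m → V, F (Fin.cons u v) := by
  rw [← Fintype.sum_prod_type', ← (Fin.consEquiv fun _ => V).sum_comp]
  rfl

/-- The matrix coefficients of a word in two matrices are sums over paths. -/
theorem prod_map_apply_eq_sum {V R : Type*} [Fintype V] [DecidableEq V] [CommRing R]
    (M : Bool → Matrix V V R) (w : List Bool) (u u' : V) :
    (w.map M).prod u u' = ∑ v : Fin (w.length + 1) → V,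
      if extendPath v 0 = u ∧ extendPath v w.length = u' then
        ∏ k ∈ Finset.range w.length, M (w.getD k false) (extendPath v k) (extendPath v (k + 1))
      else 0 := by
  induction w generalizing u with
  | nil =>
    rw [List.map_nil, List.prod_nil, List.length_nil, sum_fin_cons]
    simp only [extendPath_cons_zero, Finset.range_zero, Finset.prod_empty, Matrix.one_apply]
    simp only [Finset.univ_unique, Finset.sum_singleton, ite_and]
    simp
  | cons ε w ih =>
    rw [List.map_cons, List.prod_cons, Matrix.mul_apply, List.length_cons, sum_fin_cons]
    simp only [extendPath_cons_zero, extendPath_cons_succ, Finset.prod_range_succ',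
      List.getD_cons_succ, List.getD_cons_zero, ih, Finset.mul_sum]
    rw [Finset.sum_comm, Finset.sum_comm (s := Finset.univ (α := V))]
    refine Finset.sum_congr rfl fun v _ => ?_
    rw [Finset.sum_eq_single (extendPath v 0) (fun b _ hb => by simp [Ne.symm hb]) (by simp),
      Finset.sum_eq_single u (fun b _ hb => by simp [hb]) (by simp)]
    simp [mul_comm]

/-- The trace of a word in two matrices is a sum over closed paths. -/
theorem trace_prod_map_eq_sum {V R : Type*} [Fintype V] [DecidableEq V] [CommRing R]
    (M : Bool → Matrix V V R) (w : List Bool) :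
    (w.map M).prod.trace = ∑ v : Fin (w.length + 1) → V,
      if extendPath v w.length = extendPath v 0 then
        ∏ k ∈ Finset.range w.length, M (w.getD k false) (extendPath v k) (extendPath v (k + 1))
      else 0 := by
  simp only [Matrix.trace, Matrix.diag_apply, prod_map_apply_eq_sum, ite_and]
  rw [Finset.sum_comm]
  refine Finset.sum_congr rfl fun v _ => ?_
  simp

/-- The number of continuations, along a word, of a path in `n` vertices that clear a stack with
given letters. -/
def clearingCount (n : ℕ) : List Bool → List Bool → ℕ
  | s, [] => if s = [] then 1 else 0
  | s, ε :: w =>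
    if s.head? = some (!ε) then (n - 1) * clearingCount n (ε :: s) w + clearingCount n s.tail w
    else n * clearingCount n (ε :: s) w

/-- If the top carries the opposite letter, exactly one next vertex pops and the other `n - 1` push;
otherwise all `n` push. -/
theorem card_clearing (n : ℕ) (w : List Bool) (s : List (Bool × Fin n)) (u : Fin n) :
    (∑ v : Fin (w.length + 1) → Fin n, if extendPath v 0 = u ∧
      pathStack (fun k => w.getD k false) (extendPath v) s w.length = [] then 1 else 0) =
      clearingCount n (s.map Prod.fst) w := by
  induction w generalizing s u with
  | nil =>
    rw [List.length_nil, sum_fin_cons]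
    simp only [extendPath_cons_zero, pathStack, Finset.univ_unique, Finset.sum_singleton, ite_and]
    simp [clearingCount]
  | cons ε w ih =>
    rw [List.length_cons, sum_fin_cons]
    simp only [extendPath_cons_zero, extendPath_cons_succ, pathStack_succ_left,
      List.getD_cons_succ, List.getD_cons_zero, ite_and]
    rw [Finset.sum_eq_single u (fun b _ hb => by simp [hb]) (by simp)]
    simp only [if_true]
    have hsplit : ∀ v : Fin (w.length + 1) → Fin n,
        (if pathStack (fun k => w.getD k false) (extendPath v)
          (stackStep s ε u (extendPath v 0)) w.length = [] then 1 else 0) =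
        ∑ u' : Fin n, if extendPath v 0 = u' ∧ pathStack (fun k => w.getD k false) (extendPath v)
          (stackStep s ε u u') w.length = [] then 1 else 0 := by
      intro v
      simp [ite_and]
    rw [Finset.sum_congr rfl fun v _ => hsplit v, Finset.sum_comm,
      Finset.sum_congr rfl fun u' _ => ih (stackStep s ε u u') u', clearingCount]
    rcases s with - | ⟨⟨e, u₀⟩, s⟩
    · simp [stackStep]
    · by_cases h : e = !ε
      · have hsum : ∀ u' : Fin n,
            clearingCount n ((stackStep ((e, u₀) :: s) ε u u').map Prod.fst) w =
              if u' = u₀ then clearingCount n (s.map Prod.fst) w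
              else clearingCount n (ε :: e :: s.map Prod.fst) w := by
          intro u'
          by_cases hu : u' = u₀
          · simp [stackStep, h, hu]
          · simp [stackStep, h, hu, Ne.symm hu]
        rw [Finset.sum_congr rfl fun u' _ => hsum u', Finset.sum_ite]
        simp [h, Finset.filter_ne', Finset.filter_eq', add_comm]
      · simp [stackStep, h]

/-- The number of paths with `n` vertices that clear their stacks. -/
theorem sum_pathStack_eq_nil (n : ℕ) (w : List Bool) :
    (∑ v : Fin (w.length + 1) → Fin n,
      if pathStack (fun k => w.getD k false) (extendPath v) [] w.length = [] then 1 else 0) =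
      n * clearingCount n [] w := by
  have h : ∀ v : Fin (w.length + 1) → Fin n,
      (if pathStack (fun k => w.getD k false) (extendPath v) [] w.length = [] then 1 else 0) =
      ∑ u : Fin n, if extendPath v 0 = u ∧
        pathStack (fun k => w.getD k false) (extendPath v) [] w.length = [] then 1 else 0 := by
    intro v
    simp [ite_and]
  rw [Finset.sum_congr rfl fun v _ => h v, Finset.sum_comm,
    Finset.sum_congr rfl fun u _ => card_clearing n w [] u]
  simp

/-- A push gains a factor of order `n` and a pop gains none, while the stack height moves by one;
the powers of `√n` balance this, and `(n - 1) / n` tends to `1`. -/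
theorem tendsto_clearingCount (s w : List Bool) :
    Tendsto (fun n : ℕ => (clearingCount n s w : ℝ) * √n ^ s.length / √n ^ w.length) atTop
      (𝓝 (stackCount s w)) := by
  induction w generalizing s with
  | nil =>
    rcases s with - | ⟨e, s⟩ <;> simp [clearingCount, stackCount]
  | cons ε w ih =>
    have hpos : ∀ᶠ n : ℕ in atTop, 0 < n := eventually_gt_atTop 0
    have hpush := ih (ε :: s)
    by_cases h : s.head? = some (!ε)
    · obtain ⟨s, rfl⟩ : ∃ s', s = (!ε) :: s' := by
        rcases s with - | ⟨e, s⟩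
        · simp at h
        · exact ⟨s, by simpa using h⟩
      have hfrac : Tendsto (fun n : ℕ => 1 - 1 / (n : ℝ)) atTop (𝓝 (1 - 0)) :=
        tendsto_const_nhds.sub tendsto_one_div_atTop_nhds_zero_nat
      have hlim := (hfrac.mul hpush).add (ih s)
      simp only [stackCount, List.head?_cons, List.tail_cons, if_true, Nat.cast_add]
      rw [sub_zero, one_mul] at hlim
      refine hlim.congr' ?_
      filter_upwards [hpos] with n hn
      have hn' : (0 : ℝ) < √n := Real.sqrt_pos.2 (by exact_mod_cast hn)
      have hsq : (n : ℝ) = √n ^ 2 := (Real.sq_sqrt (by positivity)).symm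
      rw [clearingCount, if_pos h, List.tail_cons]
      push_cast [Nat.cast_sub (Nat.one_le_iff_ne_zero.2 hn.ne')]
      generalize √(n : ℝ) = r at *
      rw [hsq]
      simp only [List.length_cons]
      field_simp
      ring
    · simp only [stackCount, h, if_false, add_zero]
      refine hpush.congr' ?_
      filter_upwards [hpos] with n hn
      have hn' : (0 : ℝ) < √n := Real.sqrt_pos.2 (by exact_mod_cast hn)
      have hsq : (n : ℝ) = √n ^ 2 := (Real.sq_sqrt (by positivity)).symm
      rw [clearingCount, if_neg h]
      push_cast
      generalize √(n : ℝ) = r at *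
      rw [hsq]
      simp only [List.length_cons]
      field_simp
      ring

/-! ### Repeated labels and the pairings they induce. -/

/-- Every value of `ℓ` on `{0, …, m - 1}` is taken at least twice. -/
def IsRepeated (m : ℕ) (ℓ : ℕ → ℤ) : Prop := ∀ k < m, ∃ j < m, j ≠ k ∧ ℓ j = ℓ k

/-- Every value of `ℓ` on `{0, …, m - 1}` is taken exactly twice. -/
def IsPaired (m : ℕ) (ℓ : ℕ → ℤ) : Prop :=
  ∀ k < m, ((Finset.range m).filter fun j => ℓ j = ℓ k).card = 2

theorem IsRepeated.two_le_card {m : ℕ} {ℓ : ℕ → ℤ} (h : IsRepeated m ℓ) {k : ℕ} (hk : k < m) :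
    2 ≤ ((Finset.range m).filter fun j => ℓ j = ℓ k).card := by
  obtain ⟨j, hj, hne, e⟩ := h k hk
  rw [← Finset.card_pair hne]
  refine Finset.card_le_card fun i hi => ?_
  rcases Finset.mem_insert.1 hi with rfl | hi
  · simp [hj, e]
  · obtain rfl := Finset.mem_singleton.1 hi
    simp [hk]

/-- The positions in `o` lie in distinct fibres of `ℓ`, each with at least two elements. Equality
leaves no room for larger fibres or for fibres that miss `o`. -/
theorem IsRepeated.two_mul_card_le {m : ℕ} {ℓ : ℕ → ℤ} (h : IsRepeated m ℓ) {o : Finset ℕ}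
    (ho : o ⊆ Finset.range m) (hinj : Set.InjOn ℓ o) :
    2 * o.card ≤ m ∧ (2 * o.card = m → IsPaired m ℓ ∧ ∀ k < m, ∃ t ∈ o, ℓ t = ℓ k) := by
  have h1 : (o.image ℓ).card = o.card := Finset.card_image_of_injOn hinj
  have hsub : o.image ℓ ⊆ (Finset.range m).image ℓ := Finset.image_subset_image ho
  have h2 : o.card ≤ ((Finset.range m).image ℓ).card := h1 ▸ Finset.card_le_card hsub
  have hfib : ∀ x ∈ (Finset.range m).image ℓ,
      2 ≤ ((Finset.range m).filter fun j => ℓ j = x).card := by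
    intro x hx
    obtain ⟨k, hk, rfl⟩ := Finset.mem_image.1 hx
    exact h.two_le_card (Finset.mem_range.1 hk)
  have h3 : m = ∑ x ∈ (Finset.range m).image ℓ,
      ((Finset.range m).filter fun j => ℓ j = x).card := by
    rw [← Finset.card_eq_sum_card_image, Finset.card_range]
  have h4 : 2 * ((Finset.range m).image ℓ).card ≤ m := by
    conv_rhs => rw [h3]
    rw [mul_comm, ← smul_eq_mul]
    exact Finset.card_nsmul_le_sum _ _ _ hfib
  refine ⟨by omega, fun heq => ⟨fun k hk => ?_, fun k hk => ?_⟩⟩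
  · have h5 : ∑ x ∈ (Finset.range m).image ℓ, 2 = ∑ x ∈ (Finset.range m).image ℓ,
        ((Finset.range m).filter fun j => ℓ j = x).card := by
      rw [← h3, Finset.sum_const, smul_eq_mul]
      omega
    exact ((Finset.sum_eq_sum_iff_of_le hfib).1 h5 (ℓ k)
      (Finset.mem_image_of_mem _ (Finset.mem_range.2 hk))).symm
  · have h6 : o.image ℓ = (Finset.range m).image ℓ :=
      Finset.eq_of_subset_of_card_le hsub (by omega)
    have h7 : ℓ k ∈ o.image ℓ := h6 ▸ Finset.mem_image_of_mem _ (Finset.mem_range.2 hk)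
    obtain ⟨t, ht, e⟩ := Finset.mem_image.1 h7
    exact ⟨t, ht, e⟩

theorem IsPaired.exists_openerPairing {m : ℕ} {ℓ : ℕ → ℤ} (h : IsPaired m ℓ) {O : ℕ → Prop}
    (hO : ∀ t < m, O t → ∀ j < t, ℓ j ≠ ℓ t) (hex : ∀ k < m, ∃ t < m, O t ∧ ℓ t = ℓ k) :
    ∃ p : ℕ → ℕ, IsOpenerPairing m O p ∧ ∀ k < m, ℓ k = ℓ (p k) := by
  choose! p hp1 hp2 hp3 using hex
  have hinj : ∀ s < m, O s → ∀ t < m, O t → ℓ s = ℓ t → s = t := by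
    intro s hs hOs t ht hOt e
    rcases lt_trichotomy s t with hlt | heq | hlt
    · exact absurd e (hO t ht hOt s hlt)
    · exact heq
    · exact absurd e.symm (hO s hs hOs t hlt)
  refine ⟨p, ⟨fun k hk hOk => ?_, fun k hk _ => hp2 k hk, fun k hk k' hk' hOk hOk' e => ?_,
    fun t ht hOt => ?_⟩, fun k hk => (hp3 k hk).symm⟩
  · rcases lt_trichotomy (p k) k with hlt | heq | hlt
    · exact hlt
    · exact absurd (heq ▸ hp2 k hk) hOk
    · exact absurd (hp3 k hk).symm (hO _ (hp1 k hk) (hp2 k hk) k hlt)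
  · by_contra hne
    have hpk : p k ≠ k := fun e' => hOk (e' ▸ hp2 k hk)
    have hpk' : p k ≠ k' := fun e' => hOk' (e' ▸ hp2 k hk)
    have hsub : ({p k, k, k'} : Finset ℕ) ⊆ (Finset.range m).filter fun j => ℓ j = ℓ k := by
      intro i hi
      simp only [Finset.mem_insert, Finset.mem_singleton] at hi
      rcases hi with rfl | rfl | rfl
      · simp [hp1 k hk, hp3 k hk]
      · simp [hk]
      · simp [hk', ← hp3 i hk', ← e, hp3 k hk]
    have := Finset.card_le_card hsub
    rw [h k hk, Finset.card_eq_three.2 ⟨_, _, _, hpk, hpk', hne, rfl⟩] at this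
    omega
  · have hcard := h t ht
    obtain ⟨j, hj, hjt⟩ := Finset.exists_mem_ne (by omega) t
      (s := (Finset.range m).filter fun j => ℓ j = ℓ t)
    simp only [Finset.mem_filter, Finset.mem_range] at hj
    have hOj : ¬ O j := fun hOj => hjt (hinj j hj.1 hOj t ht hOt hj.2)
    exact ⟨j, hj.1, hOj, hinj _ (hp1 j hj.1) (hp2 j hj.1) t ht hOt ((hp3 j hj.1).trans hj.2)⟩

/-! ### Exceptional paths are negligible. -/

section Exceptional

variable {n m : ℕ}

/-- The vertices of a path as integers. -/
def intPath (v : Fin (m + 1) → Fin n) (k : ℕ) : ℤ := (extendPath v k).val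

theorem intPath_eq_iff {v v' : Fin (m + 1) → Fin n} {k k' : ℕ} :
    intPath v k = intPath v' k' ↔ extendPath v k = extendPath v' k' := by
  simp [intPath, Fin.ext_iff]

theorem eq_of_extendPath_eq {V : Type*} {v v' : Fin (m + 1) → V}
    (h : ∀ k ≤ m, extendPath v k = extendPath v' k) : v = v' := by
  funext i
  have := h i (by omega)
  have hi : (⟨min (i : ℕ) m, by omega⟩ : Fin (m + 1)) = i := by
    ext
    simp
    omega
  rwa [extendPath, extendPath, hi] at this

theorem card_le_pow_of_determined (S : Finset (Fin (m + 1) → Fin n)) (F : Finset ℕ)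
    (h : ∀ v ∈ S, ∀ v' ∈ S, (∀ k ∈ F, extendPath v k = extendPath v' k) → v = v') :
    S.card ≤ n ^ F.card := by
  classical
  have hcard : (Finset.univ : Finset (F → Fin n)).card = n ^ F.card := by simp
  rw [← hcard]
  refine Finset.card_le_card_of_injOn (fun v (k : F) => extendPath v k) (by simp) ?_
  intro v hv v' hv' e
  exact h v hv v' hv' fun k hk => congrFun e ⟨k, hk⟩

/-- The paths whose edge labels repeat for both linear forms, without the path being freely
reducible to a point by cancelling a perfect matching of its edges. -/
def IsExceptional (a b c d : ℤ) (ε : ℕ → Bool) (v : Fin (m + 1) → Fin n) : Prop :=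
  IsRepeated m (edgeLabel a b ε (intPath v)) ∧ IsRepeated m (edgeLabel c d ε (intPath v)) ∧
    ¬ (pathStack ε (extendPath v) [] m = [] ∧ IsPaired m (edgeLabel a b ε (intPath v)) ∧
      IsPaired m (edgeLabel c d ε (intPath v)))

open Classical in
/-- The pairs of positions with equal labels. -/
noncomputable def labelKernel (m : ℕ) (ℓ : ℕ → ℤ) : Finset (ℕ × ℕ) :=
  (Finset.range m ×ˢ Finset.range m).filter fun x => ℓ x.1 = ℓ x.2

theorem eq_iff_of_labelKernel_eq {ℓ ℓ' : ℕ → ℤ} (h : labelKernel m ℓ = labelKernel m ℓ') {j k : ℕ}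
    (hj : j < m) (hk : k < m) : ℓ j = ℓ k ↔ ℓ' j = ℓ' k := by
  have := Finset.ext_iff.1 h (j, k)
  simpa [labelKernel, hj, hk] using this

/-- Paths with the same coincidences of labels have differences satisfying the same homogeneous
label equations. Either a free parameter is lost, or these differences are enough test vectors to
make the paths non-exceptional. -/
theorem card_exceptional_of_labelKernel_eq {a b c d : ℤ} (ha : a ≠ 0) (hb : b ≠ 0) (hc : c ≠ 0)
    (hd : d ≠ 0) (hdet : a * d - b * c ≠ 0) (ε : ℕ → Bool) (S : Finset (Fin (m + 1) → Fin n))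
    (hS : ∀ v ∈ S, IsExceptional a b c d ε v)
    (hX : ∀ v ∈ S, ∀ v' ∈ S, labelKernel m (edgeLabel a b ε (intPath v)) =
      labelKernel m (edgeLabel a b ε (intPath v')))
    (hY : ∀ v ∈ S, ∀ v' ∈ S, labelKernel m (edgeLabel c d ε (intPath v)) =
      labelKernel m (edgeLabel c d ε (intPath v'))) :
    S.card ≤ n ^ ((m + 1) / 2) := by
  classical
  rcases S.eq_empty_or_nonempty with rfl | ⟨v₀, hv₀⟩
  · simp
  have hn : 0 < n := (extendPath v₀ 0).pos
  obtain ⟨hrX, hrY, hnot⟩ := hS v₀ hv₀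
  set lX := edgeLabel a b ε (intPath v₀) with hlX
  set lY := edgeLabel c d ε (intPath v₀) with hlY
  set O : ℕ → Prop := fun k => ∀ j < k, lX j ≠ lX k ∧ lY j ≠ lY k with hOdef
  set o := (Finset.range m).filter O with ho
  have ho_sub : o ⊆ Finset.range m := Finset.filter_subset _ _
  have hinj : ∀ l : ℕ → ℤ, (∀ t, O t → ∀ j < t, l j ≠ l t) → Set.InjOn l o := by
    intro l hl s hs t ht e
    simp only [ho, Finset.coe_filter, Finset.mem_range, Set.mem_ofPred_eq] at hs ht
    rcases lt_trichotomy s t with hlt | heq | hlt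
    · exact absurd e (hl t ht.2 s hlt)
    · exact heq
    · exact absurd e.symm (hl s hs.2 t hlt)
  have hOX : ∀ t, O t → ∀ j < t, lX j ≠ lX t := fun t ht j hj => (ht j hj).1
  have hOY : ∀ t, O t → ∀ j < t, lY j ≠ lY t := fun t ht j hj => (ht j hj).2
  obtain ⟨hcardX, heqX⟩ := hrX.two_mul_card_le ho_sub (hinj lX hOX)
  obtain ⟨-, heqY⟩ := hrY.two_mul_card_le ho_sub (hinj lY hOY)
  set F := insert 0 (o.image (· + 1)) with hF
  have hFfree : ∀ f, f ∈ F ↔ IsFreeVertex m O f := by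
    intro f
    simp only [hF, ho, Finset.mem_insert, Finset.mem_image, Finset.mem_filter, Finset.mem_range,
      IsFreeVertex]
    constructor
    · rintro (h | ⟨t, ⟨h1, h2⟩, h3⟩)
      exacts [Or.inl h, Or.inr ⟨t, h1, h2, h3.symm⟩]
    · rintro (h | ⟨t, h1, h2, h3⟩)
      exacts [Or.inl h, Or.inr ⟨t, ⟨h1, h2⟩, h3.symm⟩]
  have hFcard : F.card ≤ o.card + 1 :=
    (Finset.card_insert_le _ _).trans (Nat.add_le_add_right Finset.card_image_le _)
  -- differences of paths with equal label kernels
  have hdiff : ∀ v ∈ S, ∀ v' ∈ S, ∀ j < m, ∀ k < m,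
      (lX j = lX k → edgeLabel a b ε (intPath v - intPath v') j =
        edgeLabel a b ε (intPath v - intPath v') k) ∧
      (lY j = lY k → edgeLabel c d ε (intPath v - intPath v') j =
        edgeLabel c d ε (intPath v - intPath v') k) := by
    intro v hv v' hv' j hj k hk
    simp only [edgeLabel_sub]
    constructor <;> intro e
    · rw [(eq_iff_of_labelKernel_eq (hX v₀ hv₀ v hv) hj hk).1 e,
        (eq_iff_of_labelKernel_eq (hX v₀ hv₀ v' hv') hj hk).1 e]
    · rw [(eq_iff_of_labelKernel_eq (hY v₀ hv₀ v hv) hj hk).1 e,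
        (eq_iff_of_labelKernel_eq (hY v₀ hv₀ v' hv') hj hk).1 e]
  have hdet' : ∀ v ∈ S, ∀ v' ∈ S, (∀ k ∈ F, extendPath v k = extendPath v' k) → v = v' := by
    intro v hv v' hv' hagree
    have hzero : ∀ k ≤ m, (intPath v - intPath v') k = 0 := by
      intro k
      induction k using Nat.strong_induction_on with
      | _ k ih =>
        intro hk
        by_cases hkF : k ∈ F
        · rw [Pi.sub_apply, sub_eq_zero, intPath_eq_iff]
          exact hagree k hkF
        rw [hFfree, IsFreeVertex] at hkF
        push Not at hkF
        obtain ⟨k, rfl⟩ := Nat.exists_eq_succ_of_ne_zero hkF.1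
        have hOk : ¬ O k := fun hOk => hkF.2 k (by omega) hOk rfl
        simp only [hOdef] at hOk
        push Not at hOk
        obtain ⟨j, hj, hjk⟩ := hOk
        obtain ⟨d1, d2⟩ := hdiff v hv v' hv' j (by omega) k (by omega)
        have z1 := ih j (by omega) (by omega)
        have z2 := ih (j + 1) (by omega) (by omega)
        have z3 := ih k (by omega) (by omega)
        -- The repeated label, of either kind, gives an equation in which only the end point of edge
        -- `k` is left, with non-zero coefficient.
        by_cases hx : lX j = lX k
        · have := d1 hx
          simp only [edgeLabel, z1, z2, z3, mul_zero, zero_add] at this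
          exact (mul_eq_zero.1 this.symm).resolve_left (letterCoeff_ne_zero hb ha _)
        · have := d2 (hjk hx)
          simp only [edgeLabel, z1, z2, z3, mul_zero, zero_add] at this
          exact (mul_eq_zero.1 this.symm).resolve_left (letterCoeff_ne_zero hd hc _)
    refine eq_of_extendPath_eq fun k hk => ?_
    rw [← intPath_eq_iff, ← sub_eq_zero]
    exact hzero k hk
  rcases Nat.lt_or_ge (2 * o.card) m with hlt | hge
  · exact (card_le_pow_of_determined S F hdet').trans (Nat.pow_le_pow_right hn (by omega))
  have hom : 2 * o.card = m := le_antisymm hcardX hge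
  obtain ⟨hpairX, hexX⟩ := heqX hom
  obtain ⟨hpairY, hexY⟩ := heqY hom
  -- There are `m / 2 + 1` free vertices at most; if one of them is redundant, the bound follows.
  by_cases hred : ∃ f ∈ F, ∀ v ∈ S, ∀ v' ∈ S,
      (∀ k ∈ F.erase f, extendPath v k = extendPath v' k) → v = v'
  · obtain ⟨f, hf, h⟩ := hred
    refine (card_le_pow_of_determined S _ h).trans (Nat.pow_le_pow_right hn ?_)
    rw [Finset.card_erase_of_mem hf]
    omega
  exfalso
  push Not at hred
  have hmem : ∀ l : ℕ → ℤ, (∀ k < m, ∃ t ∈ o, l t = l k) → ∀ k < m, ∃ t < m, O t ∧ l t = l k := by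
    intro l hl k hk
    obtain ⟨t, ht, e⟩ := hl k hk
    rw [ho, Finset.mem_filter, Finset.mem_range] at ht
    exact ⟨t, ht.1, ht.2, e⟩
  obtain ⟨p, hp, hp'⟩ := hpairX.exists_openerPairing (fun t _ => hOX t) (hmem lX hexX)
  obtain ⟨q, hq, hq'⟩ := hpairY.exists_openerPairing (fun t _ => hOY t) (hmem lY hexY)
  -- Non-redundancy of `f` gives two paths agreeing at all other free vertices; they must differ at
  -- `f`, so their difference is the required test vector.
  have hR := isReversalAt_of_tests (ε := ε) ha hb hc hd hdet hp hq (by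
    intro f hf
    rw [← hFfree] at hf
    obtain ⟨v, hv, v', hv', hagree, hne⟩ := hred f hf
    have h0 : ∀ f', IsFreeVertex m O f' → f' ≠ f → (intPath v - intPath v') f' = 0 := by
      intro f' hf' hne'
      rw [Pi.sub_apply, sub_eq_zero, intPath_eq_iff]
      exact hagree f' (Finset.mem_erase.2 ⟨hne', (hFfree f').2 hf'⟩)
    refine ⟨intPath v - intPath v', fun k hk hOk => ?_, fun hz => hne ?_, h0⟩
    · have h1 := hp.lt k hk hOk
      have h2 := hq.lt k hk hOk
      exact ⟨(hdiff v hv v' hv' k hk _ (by omega)).1 (hp' k hk),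
        (hdiff v hv v' hv' k hk _ (by omega)).2 (hq' k hk)⟩
    · refine hdet' v hv v' hv' fun k hk => ?_
      by_cases hkf : k = f
      · rwa [hkf, ← intPath_eq_iff, ← sub_eq_zero]
      · exact hagree k (Finset.mem_erase.2 ⟨hkf, hk⟩))
  refine hnot ⟨pathStack_eq_nil_of_isReversalAt hp hR (fun k hk hOk => ?_)
    (fun t _ hOt s hst e1 e2 e3 => ?_), hpairX, hpairY⟩
  · obtain ⟨e1, e2, -⟩ := hR k hk hOk
    have h2 := hq' k hk
    rw [← e1] at h2
    have := eq_reverse_of_edgeLabel_eq hdet e2 (hp' k hk) h2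
    simpa only [intPath_eq_iff] using this
  · refine hOX t hOt s hst ?_
    rw [← intPath_eq_iff] at e2 e3
    rw [hlX, edgeLabel, edgeLabel, e1, e2, e3]
    cases ε t <;> simp [letterCoeff] <;> ring

open Classical in
theorem exists_card_exceptional_le {a b c d : ℤ} (ha : a ≠ 0) (hb : b ≠ 0) (hc : c ≠ 0)
    (hd : d ≠ 0) (hdet : a * d - b * c ≠ 0) (m : ℕ) (ε : ℕ → Bool) :
    ∃ C : ℕ, ∀ n : ℕ, ((Finset.univ : Finset (Fin (m + 1) → Fin n)).filter
      (IsExceptional a b c d ε)).card ≤ C * n ^ ((m + 1) / 2) := by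
  set A := (Finset.range m ×ˢ Finset.range m).powerset with hA
  refine ⟨(A ×ˢ A).card, fun n => ?_⟩
  set S := (Finset.univ : Finset (Fin (m + 1) → Fin n)).filter (IsExceptional a b c d ε)
  set g : (Fin (m + 1) → Fin n) → Finset (ℕ × ℕ) × Finset (ℕ × ℕ) := fun v =>
    (labelKernel m (edgeLabel a b ε (intPath v)), labelKernel m (edgeLabel c d ε (intPath v)))
  have himg : S.image g ⊆ A ×ˢ A := by
    intro x hx
    obtain ⟨v, -, rfl⟩ := Finset.mem_image.1 hx
    simp only [g, hA, Finset.mem_product, Finset.mem_powerset]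
    exact ⟨Finset.filter_subset _ _, Finset.filter_subset _ _⟩
  have h := Finset.card_le_mul_card_image (f := g) S (n ^ ((m + 1) / 2)) (by
    intro x _
    refine card_exceptional_of_labelKernel_eq ha hb hc hd hdet ε _ (fun v hv => ?_)
      (fun v hv v' hv' => ?_) fun v hv v' hv' => ?_
    · exact (Finset.mem_filter.1 (Finset.mem_filter.1 hv).1).2
    · exact congrArg Prod.fst ((Finset.mem_filter.1 hv).2.trans (Finset.mem_filter.1 hv').2.symm)
    · exact congrArg Prod.snd ((Finset.mem_filter.1 hv).2.trans (Finset.mem_filter.1 hv').2.symm))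
  refine h.trans ?_
  rw [mul_comm]
  exact Nat.mul_le_mul_right _ (Finset.card_le_card himg)

end Exceptional

/-! ### Mixed moments of the input variables. -/

section Moments

variable {Ω : Type*} [MeasurableSpace Ω] {P : Measure Ω} [IsProbabilityMeasure P]

/-- A complex number or its conjugate. -/
def conjLetter (ε : Bool) (z : ℂ) : ℂ := if ε then star z else z

theorem continuous_conjLetter (ε : Bool) : Continuous (conjLetter ε) := by
  cases ε
  · exact continuous_id
  · exact Complex.continuous_conj

theorem norm_conjLetter (ε : Bool) (z : ℂ) : ‖conjLetter ε z‖ = ‖z‖ := by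
  cases ε <;> simp [conjLetter]

theorem integral_conjLetter {Ω : Type*} [MeasurableSpace Ω] {P : Measure Ω} (ε : Bool)
    (f : Ω → ℂ) :
    ∫ ω, conjLetter ε (f ω) ∂P = conjLetter ε (∫ ω, f ω ∂P) := by
  cases ε
  · rfl
  · exact integral_conj

theorem measurable_prod_conjLetter {ι : Type*} (s : Finset ι) (ε : ι → Bool) :
    Measurable fun z : ℂ => ∏ k ∈ s, conjLetter (ε k) z :=
  Finset.measurable_fun_prod s fun k _ => (continuous_conjLetter (ε k)).measurable

namespace IsInputEnsemble

variable {x : ℤ → LInftyMinus P}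

theorem integral_prod_eq (hx : IsInputEnsemble x) (m : ℕ) (ε : ℕ → Bool) (ℓ : ℕ → ℤ) :
    ∫ ω, ∏ k ∈ Finset.range m, conjLetter (ε k) ((x (ℓ k) : Ω → ℂ) ω) ∂P =
      ∏ α ∈ (Finset.range m).image ℓ, ∫ ω, ∏ k ∈ (Finset.range m).filter (fun j => ℓ j = α),
        conjLetter (ε k) ((x α : Ω → ℂ) ω) ∂P := by
  have hind : iIndepFun (fun (α : (Finset.range m).image ℓ) => (x α : Ω → ℂ)) P :=
    hx.indep.precomp Subtype.val_injective
  have h := hind.integral_fun_prod_comp (𝕜 := ℂ)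
    (f := fun (α : (Finset.range m).image ℓ) z => ∏ k ∈ (Finset.range m).filter (fun j => ℓ j = α), conjLetter (ε k) z)
    (fun α => (x α).2.1.aemeasurable)
    (fun α => (measurable_prod_conjLetter _ ε).aestronglyMeasurable)
  rw [Finset.prod_coe_sort ((Finset.range m).image ℓ) fun α =>
    ∫ ω, ∏ k ∈ (Finset.range m).filter (fun j => ℓ j = α),
      conjLetter (ε k) ((x α : Ω → ℂ) ω) ∂P] at h
  rw [← h]
  refine integral_congr_ae (Eventually.of_forall fun ω => ?_)
  simp only
  rw [Finset.prod_coe_sort ((Finset.range m).image ℓ) fun α =>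
      ∏ k ∈ (Finset.range m).filter (fun j => ℓ j = α), conjLetter (ε k) ((x α : Ω → ℂ) ω),
    ← Finset.prod_fiberwise_of_maps_to (g := ℓ) (t := (Finset.range m).image ℓ)
      fun k hk => Finset.mem_image_of_mem _ hk]
  refine Finset.prod_congr rfl fun α _ => Finset.prod_congr rfl fun k hk => ?_
  rw [(Finset.mem_filter.1 hk).2]

theorem integral_prod_eq_zero (hx : IsInputEnsemble x) {m : ℕ} (ε : ℕ → Bool) {ℓ : ℕ → ℤ}
    (h : ¬ IsRepeated m ℓ) :
    ∫ ω, ∏ k ∈ Finset.range m, conjLetter (ε k) ((x (ℓ k) : Ω → ℂ) ω) ∂P = 0 := by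
  rw [IsRepeated] at h
  push Not at h
  obtain ⟨k, hk, hne⟩ := h
  rw [hx.integral_prod_eq]
  refine Finset.prod_eq_zero (Finset.mem_image_of_mem ℓ (Finset.mem_range.2 hk)) ?_
  have hfib : (Finset.range m).filter (fun j => ℓ j = ℓ k) = {k} := by
    ext j
    simp only [Finset.mem_filter, Finset.mem_range, Finset.mem_singleton]
    constructor
    · rintro ⟨h1, h2⟩
      by_contra h3
      exact hne j h1 h3 h2
    · rintro rfl
      exact ⟨hk, rfl⟩
  simp only [hfib, Finset.prod_singleton]
  rw [integral_conjLetter, hx.mean_zero]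
  cases ε k <;> simp [conjLetter]

/-- A zero signed count means that the two occurrences of a label are a variable and its conjugate,
so each factor is `E |x|²`. -/
theorem integral_prod_eq_one (hx : IsInputEnsemble x) {m : ℕ} {ε : ℕ → Bool} {ℓ : ℕ → ℤ}
    (h : IsPaired m ℓ) (hbal : ∀ α, ∑ k ∈ Finset.range m,
      (if ℓ k = α then (if ε k then -1 else 1) else 0 : ℤ) = 0) :
    ∫ ω, ∏ k ∈ Finset.range m, conjLetter (ε k) ((x (ℓ k) : Ω → ℂ) ω) ∂P = 1 := by
  rw [hx.integral_prod_eq]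
  refine Finset.prod_eq_one fun α hα => ?_
  obtain ⟨k, hk, rfl⟩ := Finset.mem_image.1 hα
  obtain ⟨i, j, hij, hfib⟩ := Finset.card_eq_two.1 (h k (Finset.mem_range.1 hk))
  have hb := hbal (ℓ k)
  rw [← Finset.sum_filter, hfib, Finset.sum_pair hij] at hb
  have hprod : ∀ z : ℂ, conjLetter (ε i) z * conjLetter (ε j) z = ((‖z‖ ^ 2 : ℝ) : ℂ) := by
    intro z
    have h1 : (starRingEnd ℂ) z * z = ((‖z‖ ^ 2 : ℝ) : ℂ) := by
      rw [Complex.conj_mul']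
      push_cast
      rfl
    cases hi : ε i <;> cases hj : ε j
    · simp [hi, hj] at hb
    · rw [mul_comm]
      exact h1
    · exact h1
    · simp [hi, hj] at hb
  simp only [hfib, Finset.prod_pair hij, hprod]
  rw [integral_complex_ofReal, hx.unit_variance, Complex.ofReal_one]

theorem exists_integral_pow_le (hx : IsInputEnsemble x) (r : ℕ) :
    ∃ C : ℝ, ∀ α, ∫ ω, ‖(x α : Ω → ℂ) ω‖ ^ (r + 1) ∂P ≤ C := by
  have hsup := hx.bounded_moments (r + 1 : ℕ) (by simp)
  refine ⟨(⨆ α, ∫⁻ ω, ‖(x α : Ω → ℂ) ω‖ₑ ^ ((r + 1 : ℕ) : ℝ) ∂P).toReal, fun α => ?_⟩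
  have h1 : ∫ ω, ‖(x α : Ω → ℂ) ω‖ ^ (r + 1) ∂P =
      (∫⁻ ω, ‖(x α : Ω → ℂ) ω‖ₑ ^ ((r + 1 : ℕ) : ℝ) ∂P).toReal := by
    have h2 := integral_norm_eq_lintegral_enorm (μ := P)
      ((x α).2.1.pow_const (r + 1)).aestronglyMeasurable
    simpa only [norm_pow, enorm_pow, ENNReal.rpow_natCast] using h2
  rw [h1]
  exact ENNReal.toReal_mono hsup.ne
    (le_iSup (fun α => ∫⁻ ω, ‖(x α : Ω → ℂ) ω‖ₑ ^ ((r + 1 : ℕ) : ℝ) ∂P) α)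

theorem _root_.prod_le_one_add_sum_pow (m : ℕ) (a : ℕ → ℝ) (ha : ∀ k, 0 ≤ a k) :
    ∏ k ∈ Finset.range m, a k ≤ 1 + ∑ k ∈ Finset.range m, a k ^ (m + 1) := by
  have hnonneg : ∀ k ∈ Finset.range m, 0 ≤ a k ^ (m + 1) := fun k _ => pow_nonneg (ha k) _
  rcases (Finset.range m).eq_empty_or_nonempty with h | h
  · simp [h]
  obtain ⟨i, hi, hmax⟩ := Finset.exists_max_image _ a h
  have h1 : ∏ k ∈ Finset.range m, a k ≤ a i ^ m := by
    refine (Finset.prod_le_prod (fun k _ => ha k) hmax).trans_eq ?_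
    rw [Finset.prod_const, Finset.card_range]
  have h2 : a i ^ m ≤ 1 + a i ^ (m + 1) := by
    rcases le_total (a i) 1 with h3 | h3
    · linarith [pow_le_one₀ (ha i) h3 (n := m), pow_nonneg (ha i) (m + 1)]
    · linarith [pow_le_pow_right₀ h3 (Nat.le_add_right m 1)]
  linarith [Finset.single_le_sum hnonneg hi]

theorem exists_norm_integral_prod_le (hx : IsInputEnsemble x) (m : ℕ) :
    ∃ C : ℝ, ∀ (ε : ℕ → Bool) (ℓ : ℕ → ℤ),
      ‖∫ ω, ∏ k ∈ Finset.range m, conjLetter (ε k) ((x (ℓ k) : Ω → ℂ) ω) ∂P‖ ≤ C := by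
  obtain ⟨C, hC⟩ := hx.exists_integral_pow_le m
  -- The exponent `m + 1` stays at least `1` even for the empty product, as the moment hypothesis
  -- requires.
  refine ⟨1 + m * C, fun ε ℓ => ?_⟩
  have hint : ∀ α, Integrable (fun ω => ‖(x α : Ω → ℂ) ω‖ ^ (m + 1)) P := by
    intro α
    have := (LInftyMinus.integrable P (x α ^ (m + 1))).norm
    simpa using this
  have hsum : Integrable (fun ω => ∑ k ∈ Finset.range m, ‖(x (ℓ k) : Ω → ℂ) ω‖ ^ (m + 1)) P :=
    integrable_finsetSum _ fun k _ => hint (ℓ k)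
  refine (norm_integral_le_integral_norm _).trans ?_
  calc ∫ ω, ‖∏ k ∈ Finset.range m, conjLetter (ε k) ((x (ℓ k) : Ω → ℂ) ω)‖ ∂P
      ≤ ∫ ω, (1 + ∑ k ∈ Finset.range m, ‖(x (ℓ k) : Ω → ℂ) ω‖ ^ (m + 1)) ∂P := by
        refine integral_mono_of_nonneg (Eventually.of_forall fun ω => norm_nonneg _)
          ((integrable_const 1).add hsum) (Eventually.of_forall fun ω => ?_)
        simp only [norm_prod, norm_conjLetter]
        exact prod_le_one_add_sum_pow m (fun k => ‖(x (ℓ k) : Ω → ℂ) ω‖) fun k => norm_nonneg _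
    _ = 1 + ∑ k ∈ Finset.range m, ∫ ω, ‖(x (ℓ k) : Ω → ℂ) ω‖ ^ (m + 1) ∂P := by
        rw [integral_add (integrable_const 1) hsum, integral_finsetSum _ fun k _ => hint (ℓ k)]
        simp
    _ ≤ 1 + m * C := by
        have := Finset.sum_le_card_nsmul (Finset.range m) _ C fun k _ => hC (ℓ k)
        rw [Finset.card_range, nsmul_eq_mul] at this
        linarith

end IsInputEnsemble

theorem integral_prod_mul_prod_eq {x y : ℤ → LInftyMinus P}
    (hxy : IndepFun (fun ω α => (x α : Ω → ℂ) ω) (fun ω α => (y α : Ω → ℂ) ω) P) (m : ℕ)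
    (ε : ℕ → Bool) (ℓ ℓ' : ℕ → ℤ) :
    ∫ ω, (∏ k ∈ Finset.range m, conjLetter (ε k) ((x (ℓ k) : Ω → ℂ) ω)) *
        ∏ k ∈ Finset.range m, conjLetter (ε k) ((y (ℓ' k) : Ω → ℂ) ω) ∂P =
      (∫ ω, ∏ k ∈ Finset.range m, conjLetter (ε k) ((x (ℓ k) : Ω → ℂ) ω) ∂P) *
        ∫ ω, ∏ k ∈ Finset.range m, conjLetter (ε k) ((y (ℓ' k) : Ω → ℂ) ω) ∂P := by
  have hmeas : ∀ l : ℕ → ℤ,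
      Measurable fun g : ℤ → ℂ => ∏ k ∈ Finset.range m, conjLetter (ε k) (g (l k)) := fun l =>
    Finset.measurable_fun_prod _ fun k _ =>
      (continuous_conjLetter (ε k)).measurable.comp (measurable_pi_apply (l k))
  have hm : ∀ z : ℤ → LInftyMinus P, AEMeasurable (fun ω α => (z α : Ω → ℂ) ω) P := fun z =>
    (measurable_pi_lambda _ fun α => (z α).2.1).aemeasurable
  exact hxy.integral_fun_comp_mul_comp (hm x) (hm y) (hmeas ℓ).aestronglyMeasurable
    (hmeas ℓ').aestronglyMeasurable

end Moments

/-! ### Reduction of `*`-convergence to words. -/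

theorem FreeAlgebra.mem_span_range_words {R X : Type*} [CommSemiring R] (Q : FreeAlgebra R X) :
    Q ∈ Submodule.span R (Set.range fun w : List X => (w.map (FreeAlgebra.ι R)).prod) := by
  set T := Submodule.span R (Set.range fun w : List X => (w.map (FreeAlgebra.ι R)).prod)
  have key : ∀ Q : FreeAlgebra R X, ∀ S ∈ T, Q * S ∈ T := by
    intro Q
    induction Q using FreeAlgebra.induction with
    | grade0 r =>
      intro S hS
      rw [← Algebra.smul_def]
      exact T.smul_mem r hS
    | grade1 x =>
      intro S hS
      induction hS using Submodule.span_induction with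
      | mem S hS =>
        obtain ⟨w, rfl⟩ := hS
        exact Submodule.subset_span ⟨x :: w, by simp⟩
      | zero => simp
      | add S S' _ _ h h' => simpa only [mul_add] using T.add_mem h h'
      | smul r S _ h => simpa only [mul_smul_comm] using T.smul_mem r h
    | mul Q Q' h h' =>
      intro S hS
      rw [mul_assoc]
      exact h _ (h' _ hS)
    | add Q Q' h h' =>
      intro S hS
      rw [add_mul]
      exact T.add_mem (h _ hS) (h' _ hS)
  simpa using key Q 1 (Submodule.subset_span ⟨[], by simp⟩)

theorem convergesInStarDistribution_of_words {A : ℕ → Type*} [∀ n, Ring (A n)]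
    [∀ n, StarRing (A n)] [∀ n, Algebra ℂ (A n)] [∀ n, StarModule ℂ (A n)]
    {φ : ∀ n, StarState (A n)} {a : ∀ n, A n} {B : Type*} [Ring B] [StarRing B] [Algebra ℂ B]
    [StarModule ℂ B] {ψ : StarState B} {b : B}
    (h : ∀ w : List Bool, Tendsto
      (fun n => (φ n).toLin (w.map fun ε => if ε then star (a n) else a n).prod) atTop
      (𝓝 (ψ.toLin (w.map fun ε => if ε then star b else b).prod))) :
    ConvergesInStarDistribution φ a ψ b := by
  intro Q
  induction FreeAlgebra.mem_span_range_words Q using Submodule.span_induction with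
  | mem Q hQ =>
    obtain ⟨w, rfl⟩ := hQ
    simpa [starDistribution, map_list_prod, Function.comp_def] using h w
  | zero => simp
  | add Q Q' _ _ h h' => simpa only [map_add] using h.add h'
  | smul r Q _ h => simpa only [map_smul] using h.const_smul r

theorem prod_map_smul {R A : Type*} [CommSemiring R] [Semiring A] [Algebra R A] {ι : Type*}
    (r : R) (f : ι → A) (w : List ι) :
    (w.map fun i => r • f i).prod = r ^ w.length • (w.map f).prod := by
  induction w with
  | nil => simp
  | cons i w ih => rw [List.map_cons, List.prod_cons, ih, smul_mul_smul_comm, List.length_cons,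
      pow_succ', List.map_cons, List.prod_cons]

/-! ### Weights of paths and their asymptotic sum. -/

section Balance

variable {n m : ℕ} {a b : ℤ} {ε : ℕ → Bool} {v : Fin (m + 1) → Fin n}

/-- Reversing an edge keeps its label and flips its letter, so the signed indicator of a label is an
antisymmetric edge weight. -/
theorem sum_sign_eq_zero_of_pathStack_eq_nil (h : pathStack ε (extendPath v) [] m = []) (α : ℤ) :
    ∑ k ∈ Finset.range m, (if edgeLabel a b ε (intPath v) k = α then
      (if ε k then -1 else 1) else 0 : ℤ) = 0 := by
  refine sum_eq_zero_of_pathStack_eq_nil (φ := fun e (u u' : Fin n) =>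
    if letterCoeff a b e * u.val + letterCoeff b a e * u'.val = α then
      (if e then -1 else 1) else 0) ?_ h
  intro e u u'
  cases e <;> simp [letterCoeff, add_comm] <;> split_ifs <;> rfl

theorem isRepeated_of_pathStack_eq_nil (h : pathStack ε (extendPath v) [] m = []) :
    IsRepeated m (edgeLabel a b ε (intPath v)) := by
  intro k hk
  by_contra hcon
  push Not at hcon
  have hsum := sum_sign_eq_zero_of_pathStack_eq_nil (a := a) (b := b) h
    (edgeLabel a b ε (intPath v) k)
  rw [Finset.sum_eq_single k (fun j hj hjk => if_neg (hcon j (Finset.mem_range.1 hj) hjk))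
    (fun hk' => absurd (Finset.mem_range.2 hk) hk'), if_pos rfl] at hsum
  cases hε : ε k <;> simp [hε] at hsum

end Balance

section PathWeight

variable {Ω : Type*} [MeasurableSpace Ω] {P : Measure Ω} [IsProbabilityMeasure P]

/-- The expectation of the product of the entries along a path. -/
noncomputable def pathWeight (x y : ℤ → LInftyMinus P) (a b c d e f : ℤ) (ε : ℕ → Bool) {m n : ℕ}
    (v : Fin (m + 1) → Fin n) : ℂ :=
  (∫ ω, ∏ k ∈ Finset.range m, conjLetter (ε k)
    ((x (edgeLabel a b ε (intPath v) k + (a + b + e)) : Ω → ℂ) ω) ∂P) *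
  ∫ ω, ∏ k ∈ Finset.range m, conjLetter (ε k)
    ((y (edgeLabel c d ε (intPath v) k + (c + d + f)) : Ω → ℂ) ω) ∂P

theorem isRepeated_add_const {m : ℕ} {ℓ : ℕ → ℤ} (c : ℤ) :
    IsRepeated m (fun k => ℓ k + c) ↔ IsRepeated m ℓ := by
  simp [IsRepeated]

theorem isPaired_add_const {m : ℕ} {ℓ : ℕ → ℤ} (c : ℤ) :
    IsPaired m (fun k => ℓ k + c) ↔ IsPaired m ℓ := by
  simp [IsPaired]

variable {x y : ℤ → LInftyMinus P} {a b c d : ℤ}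

theorem pathWeight_eq_zero_left (hx : IsInputEnsemble x) (e f : ℤ) {ε : ℕ → Bool} {m n : ℕ}
    {v : Fin (m + 1) → Fin n} (h : ¬ IsRepeated m (edgeLabel a b ε (intPath v))) :
    pathWeight x y a b c d e f ε v = 0 := by
  rw [pathWeight, hx.integral_prod_eq_zero ε (ℓ := fun k => edgeLabel a b ε (intPath v) k +
    (a + b + e)) (by rwa [isRepeated_add_const]), zero_mul]

theorem pathWeight_eq_zero_right (hy : IsInputEnsemble y) (e f : ℤ) {ε : ℕ → Bool} {m n : ℕ}
    {v : Fin (m + 1) → Fin n} (h : ¬ IsRepeated m (edgeLabel c d ε (intPath v))) :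
    pathWeight x y a b c d e f ε v = 0 := by
  rw [pathWeight, hy.integral_prod_eq_zero ε (ℓ := fun k => edgeLabel c d ε (intPath v) k +
    (c + d + f)) (by rwa [isRepeated_add_const]), mul_zero]

theorem integral_prod_eq_one_of_pathStack_eq_nil (hx : IsInputEnsemble x) (e : ℤ) {ε : ℕ → Bool}
    {m n : ℕ} {v : Fin (m + 1) → Fin n} (h : pathStack ε (extendPath v) [] m = [])
    (hX : IsPaired m (edgeLabel a b ε (intPath v))) :
    ∫ ω, ∏ k ∈ Finset.range m, conjLetter (ε k)
      ((x (edgeLabel a b ε (intPath v) k + e) : Ω → ℂ) ω) ∂P = 1 := by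
  refine hx.integral_prod_eq_one (ℓ := fun k => edgeLabel a b ε (intPath v) k + e)
    (by rwa [isPaired_add_const]) fun α => ?_
  simp only [← eq_sub_iff_add_eq]
  exact sum_sign_eq_zero_of_pathStack_eq_nil h (α - e)

-- Outside the exceptional set the weight of a closed path equals the indicator of clearing the
-- stack; on it both are bounded uniformly.
open Classical in
theorem exists_norm_pathWeight_sub_le (hx : IsInputEnsemble x) (hy : IsInputEnsemble y)
    (e f : ℤ) (ε : ℕ → Bool) (m : ℕ) :
    ∃ C : ℝ, 0 ≤ C ∧ ∀ (n : ℕ) (v : Fin (m + 1) → Fin n),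
      ‖(if extendPath v m = extendPath v 0 then pathWeight x y a b c d e f ε v else 0) -
        ((if pathStack ε (extendPath v) [] m = [] then 1 else 0 : ℕ) : ℂ)‖ ≤
      if IsExceptional a b c d ε v then C else 0 := by
  obtain ⟨C, hC⟩ := hx.exists_norm_integral_prod_le m
  obtain ⟨C', hC'⟩ := hy.exists_norm_integral_prod_le m
  have hC0 : 0 ≤ C := (norm_nonneg _).trans (hC ε 0)
  have hC0' : 0 ≤ C' := (norm_nonneg _).trans (hC' ε 0)
  refine ⟨C * C' + 1, by positivity, fun n v => ?_⟩
  by_cases hexc : IsExceptional a b c d ε v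
  · rw [if_pos hexc]
    refine (norm_sub_le _ _).trans (add_le_add ?_ ?_)
    · split_ifs
      · rw [pathWeight, norm_mul]
        exact mul_le_mul (hC _ _) (hC' _ _) (norm_nonneg _) hC0
      · rw [norm_zero]
        positivity
    · split_ifs <;> simp
  · rw [if_neg hexc]
    by_cases hX : IsRepeated m (edgeLabel a b ε (intPath v))
    · by_cases hY : IsRepeated m (edgeLabel c d ε (intPath v))
      · obtain ⟨h1, h2, h3⟩ := not_not.1 fun h => hexc ⟨hX, hY, h⟩
        rw [if_pos (eq_of_pathStack_eq_nil h1), if_pos h1, pathWeight,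
          integral_prod_eq_one_of_pathStack_eq_nil hx _ h1 h2,
          integral_prod_eq_one_of_pathStack_eq_nil hy _ h1 h3]
        simp
      · rw [pathWeight_eq_zero_right hy e f hY,
          if_neg fun h => hY (isRepeated_of_pathStack_eq_nil h)]
        simp
    · rw [pathWeight_eq_zero_left hx e f hX,
        if_neg fun h => hX (isRepeated_of_pathStack_eq_nil h)]
      simp

/-- The normalized sum of the weights of closed paths converges. -/
theorem tendsto_sum_pathWeight (hx : IsInputEnsemble x) (hy : IsInputEnsemble y)
    (ha : a ≠ 0) (hb : b ≠ 0) (hc : c ≠ 0) (hd : d ≠ 0) (hdet : a * d - b * c ≠ 0) (e f : ℤ)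
    (w : List Bool) :
    Tendsto (fun n : ℕ => (((n : ℝ)⁻¹ * (√n)⁻¹ ^ w.length : ℝ) : ℂ) *
      ∑ v : Fin (w.length + 1) → Fin n, if extendPath v w.length = extendPath v 0 then
        pathWeight x y a b c d e f (fun k => w.getD k false) v else 0) atTop
      (𝓝 (stackCount [] w)) := by
  classical
  set m := w.length with hm
  set ε : ℕ → Bool := fun k => w.getD k false with hε
  obtain ⟨C, hC0, hC⟩ := exists_norm_pathWeight_sub_le (a := a) (b := b) (c := c) (d := d)
    hx hy e f ε m
  obtain ⟨K, hK⟩ := exists_card_exceptional_le ha hb hc hd hdet m ε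
  have hmain : Tendsto (fun n : ℕ => (((n : ℝ)⁻¹ * (√n)⁻¹ ^ m : ℝ) : ℂ) *
      ((∑ v : Fin (m + 1) → Fin n, if pathStack ε (extendPath v) [] m = [] then 1 else 0 : ℕ) : ℂ))
      atTop (𝓝 (stackCount [] w)) := by
    have h := (Complex.continuous_ofReal.tendsto _).comp (tendsto_clearingCount [] w)
    rw [Complex.ofReal_natCast] at h
    refine h.congr' ?_
    filter_upwards [eventually_gt_atTop 0] with n hn
    have hn' : (n : ℂ) ≠ 0 := by exact_mod_cast hn.ne'
    rw [hm, hε, sum_pathStack_eq_nil]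
    simp only [Function.comp_apply]
    push_cast
    rw [List.length_nil, pow_zero, mul_one, inv_pow, mul_mul_mul_comm, inv_mul_cancel₀ hn', one_mul,
      div_eq_mul_inv, mul_comm]
  have hlim0 : Tendsto (fun n : ℕ => C * K * (√n)⁻¹) atTop (𝓝 0) := by
    have h1 : Tendsto (fun n : ℕ => (√(n : ℝ))⁻¹) atTop (𝓝 0) :=
      tendsto_inv_atTop_zero.comp (Real.tendsto_sqrt_atTop.comp tendsto_natCast_atTop_atTop)
    simpa using h1.const_mul (C * K)
  have hdiff := squeeze_zero_norm' (f := fun n : ℕ => (((n : ℝ)⁻¹ * (√n)⁻¹ ^ m : ℝ) : ℂ) *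
      (∑ v : Fin (m + 1) → Fin n, if extendPath v m = extendPath v 0 then
        pathWeight x y a b c d e f ε v else 0) - (((n : ℝ)⁻¹ * (√n)⁻¹ ^ m : ℝ) : ℂ) *
      ((∑ v : Fin (m + 1) → Fin n, if pathStack ε (extendPath v) [] m = [] then 1 else 0 : ℕ) : ℂ))
    (by
      filter_upwards [eventually_gt_atTop 0] with n hn
      have hn1 : (1 : ℝ) ≤ n := by exact_mod_cast hn
      have hr1 : 1 ≤ √(n : ℝ) := Real.one_le_sqrt.2 hn1
      have hr : (0 : ℝ) < √n := zero_lt_one.trans_le hr1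
      have hsq : (n : ℝ) = √n ^ 2 := (Real.sq_sqrt (by positivity)).symm
      rw [← mul_sub, norm_mul, Nat.cast_sum, ← Finset.sum_sub_distrib, Complex.norm_real,
        Real.norm_of_nonneg (by positivity)]
      have hsum : ‖∑ v : Fin (m + 1) → Fin n, ((if extendPath v m = extendPath v 0 then
          pathWeight x y a b c d e f ε v else 0) -
          ((if pathStack ε (extendPath v) [] m = [] then 1 else 0 : ℕ) : ℂ))‖ ≤
          C * (K * √n ^ (m + 1)) := by
        refine (norm_sum_le_of_le _ fun v _ => hC n v).trans ?_
        rw [← Finset.sum_filter, Finset.sum_const, nsmul_eq_mul, mul_comm]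
        refine mul_le_mul_of_nonneg_left ?_ hC0
        refine (Nat.cast_le.2 (hK n)).trans ?_
        push_cast
        refine mul_le_mul_of_nonneg_left ?_ (Nat.cast_nonneg K)
        rw [hsq, Real.sqrt_sq hr.le, ← pow_mul]
        exact pow_le_pow_right₀ hr1 (by omega)
      -- The normalization `n * √n ^ m` beats the bound of order `√n ^ (m + 1)` by a factor `√n`.
      refine (mul_le_mul_of_nonneg_left hsum (by positivity)).trans_eq ?_
      generalize √(n : ℝ) = r at *
      rw [hsq, inv_pow]
      field_simp
      ring) hlim0
  simpa using hdiff.add hmain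

/-- The expected trace of a word in the matrix and its adjoint as a sum over closed paths. -/
theorem expectation_trace_prod_map
    (hxy : IndepFun (fun ω α => (x α : Ω → ℂ) ω) (fun ω α => (y α : Ω → ℂ) ω) P) (e f : ℤ)
    (n : ℕ) (w : List Bool) :
    LInftyMinus.expectation P ((w.map fun ε : Bool =>
      if ε then star (patternedMatrix n (linearLink a b e) x ⊙
        patternedMatrix n (linearLink c d f) y)
      else patternedMatrix n (linearLink a b e) x ⊙
        patternedMatrix n (linearLink c d f) y).prod.trace) =
      ∑ v : Fin (w.length + 1) → Fin n, if extendPath v w.length = extendPath v 0 then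
        pathWeight x y a b c d e f (fun k => w.getD k false) v else 0 := by
  rw [trace_prod_map_eq_sum, map_sum]
  refine Finset.sum_congr rfl fun v _ => ?_
  split_ifs
  swap
  · rw [map_zero]
  have hcoe : ∀ (s : Finset ℕ) (g : ℕ → LInftyMinus P) (ω : Ω),
      ((∏ k ∈ s, g k : LInftyMinus P) : Ω → ℂ) ω = ∏ k ∈ s, (g k : Ω → ℂ) ω := by
    intro s g ω
    induction s using Finset.induction_on with
    | empty => rfl
    | insert k s hk ih =>
      rw [Finset.prod_insert hk, Finset.prod_insert hk, ← ih]
      rfl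
  rw [pathWeight, ← integral_prod_mul_prod_eq hxy]
  refine integral_congr_ae (Eventually.of_forall fun ω => ?_)
  simp only
  rw [hcoe, ← Finset.prod_mul_distrib]
  refine Finset.prod_congr rfl fun k _ => ?_
  -- Vertices are counted from `0` but matrix indices from `1`, whence the shift by `a + b`.
  have hlab : ∀ a b e : ℤ, edgeLabel a b (fun k => w.getD k false) (intPath v) k + (a + b + e) =
      if w.getD k false then
        linearLink a b e ((extendPath v (k + 1)).val + 1) ((extendPath v k).val + 1)
      else linearLink a b e ((extendPath v k).val + 1) ((extendPath v (k + 1)).val + 1) := by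
    intro a b e
    cases h : w.getD k false <;> simp only [edgeLabel, letterCoeff, linearLink, intPath, h,
      Bool.false_eq_true, if_false, if_true] <;> push_cast <;> ring
  rw [hlab, hlab]
  cases h : w.getD k false
  · rfl
  · simp only [conjLetter, if_true]
    rw [← star_mul']
    rfl

end PathWeight

theorem mainTheorem4 {Ω : Type*} [MeasurableSpace Ω] (P : Measure Ω) [IsProbabilityMeasure P]
    (x y : ℤ → LInftyMinus P) (hx : IsInputEnsemble x) (hy : IsInputEnsemble y)
    (hxy : IndepFun (fun ω α => (x α : Ω → ℂ) ω) (fun ω α => (y α : Ω → ℂ) ω) P)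
    (a b c d e f : ℤ) (ha : a ≠ 0) (hb : b ≠ 0) (hc : c ≠ 0) (hd : d ≠ 0)
    (hdet : a * d - b * c ∉ ({0, b * d, -(b * d), a * c, -(a * c)} : Set ℤ)) :
    ∃ (B : Type) (_ : Ring B) (_ : StarRing B) (_ : Algebra ℂ B) (_ : StarModule ℂ B)
      (ψ : StarState B) (z : B), IsCircular ψ z ∧
      ConvergesInStarDistribution
        (fun n : ℕ => matrixState P (n + 1))
        (fun n : ℕ => ((Real.sqrt ((n + 1 : ℕ) : ℝ) : ℝ) : ℂ)⁻¹ •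
          (patternedMatrix (n + 1) (linearLink a b e) x ⊙
            patternedMatrix (n + 1) (linearLink c d f) y))
        ψ z := by

  have hdet' : a * d - b * c ≠ 0 := fun h => hdet (by simp [h])
  refine ⟨FockSpace →L[ℂ] FockSpace, inferInstance, inferInstance, inferInstance, inferInstance,
    FockSpace.vacuumState, FockSpace.circularOp, FockSpace.isCircular_circularOp,
    convergesInStarDistribution_of_words fun w => ?_⟩
  have hlim := (tendsto_sum_pathWeight hx hy ha hb hc hd hdet' e f w).comp (tendsto_add_atTop_nat 1)
  have hval : FockSpace.vacuumState.toLin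
      (w.map fun ε => if ε then star FockSpace.circularOp else FockSpace.circularOp).prod =
      (stackCount [] w : ℂ) := FockSpace.vacuumState_prod_circularLetter w
  rw [hval]
  refine hlim.congr fun n => ?_
  set A := patternedMatrix (n + 1) (linearLink a b e) x ⊙
    patternedMatrix (n + 1) (linearLink c d f) y with hA
  set r : ℂ := ((Real.sqrt ((n + 1 : ℕ) : ℝ) : ℝ) : ℂ)⁻¹ with hr
  have hstar : star r = r := by
    rw [hr, star_inv₀]
    congr 1
    exact Complex.conj_ofReal _
  have hletter : (fun ε : Bool => if ε then star (r • A) else r • A) =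
      fun ε => r • (if ε then star A else A) := by
    funext ε
    cases ε
    · rfl
    · simp only [if_true]
      rw [star_smul, hstar]
  rw [hletter, prod_map_smul, map_smul, Function.comp_apply, ← expectation_trace_prod_map hxy,
    ← hA]
  change _ = r ^ w.length • (((n + 1 : ℕ) : ℂ)⁻¹ •
    LInftyMinus.expectation P (Matrix.trace _))
  rw [smul_smul, smul_eq_mul]
  congr 1
  push_cast
  rw [hr]
  push_cast
  ring
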